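/- Let $\pi:X\to\mathrm{Spec}\,\mathcal O_F$ be a regular arithmetic surface over a number field $F$ (an integral regular scheme of dimension 2, proper and flat over $\mathcal O_F$). Let $C\subset X$ be an irreducible curve, vertical or horizontal, and let $x$ be a closed point of $C$. Put $R=\widehat{\mathcal O}_{X,x}$, with maximal ideal $\mathfrak m$, and $H=\mathrm{Frac}(R)^*$. Let $I\subset R$ be the ideal generated by the ideal of $C$ in $\mathcal O_{X,x}$, generated by a local equation $t$ of $C$ at $x$. Let $\mathcal O_{K_{C,x}}=\prod_{\mathfrak p}\widehat{R_{\mathfrak p}}$, the product over the minimal primes $\mathfrak p$ of $I$ (the formal branches of $C$ at $x$), let $K_{C,x}=\mathrm{Frac}(R)\otimes_R\mathcal O_{K_{C,x}}$, the direct sum of the corresponding two-dimensional local fields, and let $B_x=\bigcup_n (R:_{\mathrm{Frac}(R)}I^n)=R[1/t]$ ("Laurent series along $C$"), regarded as a subspace of $K_{C,x}$. For $A_0=B_x$ or $A_0=\mathcal O_{K_{C,x}}$, consider the $R$-submodules $hA_0\subset K_{C,x}$ with $h\in H$. For two of them, $C'\subset A$, the quotient $A/C'$ is a locally compact group: a subgroup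 is compact open if and only if it contains an $R$-lattice and is contained in an $R$-lattice, where an $R$-lattice is a finitely generated $R$-submodule with $\mathfrak m$-power torsion quotient. Any two compact open subgroups are commensurable. Let $\mathrm{Num}(A/C')$ be the $\mathbb R$-torsor of functions $n$ from the set of compact open subgroups to $\mathbb R$ with $n(U')=n(U)+\log[U':U]$ for $U\subset U'$. For two of these submodules $A,A'$ let $$[A|A']_2=\varprojlim_{C'\subset A\cap A'}\mathrm{Hom}_{\mathbb R}\big(\mathrm{Num}(A/C'),\mathrm{Num}(A'/C')\big),$$ where $C'$ runs over the submodules $hA_0$, $h\in H$, contained in $A\cap A'$, the transition maps being induced by $\mathrm{Num}(A/C'')\cong\mathrm{Num}(A/C')\otimes\mathrm{Num}(C'/C'')$ for $C''\subset C'$. The pairs $(f,\alpha)$ with $f\in H$ and $\alpha\in[A_0|fA_0]_2$, with the multiplication $(f_1,\alpha_1)\circ(f_2,\alpha_2)=(f_1f_2,\alpha_1\cdot f_1(\alpha_2))$, form a central extension of $H$ by $\mathbb R$. For $f_1,f_2\in H$ let $[f_1,f_2]_{x,C}$ (for $A_0=B_x$), respectively $[f_1,f_2]_{C,x}$ (for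 $A_0=\mathcal O_{K_{C,x}}$), be the commutator of arbitrary lifts of $f_1,f_2$ to this extension; it lies in the central subgroup $\mathbb R$ and does not depend on the lifts. Then these central extensions are well defined, and for all $f_1,f_2\in H$, with the group law of the central subgroup $\mathbb R$ written multiplicatively, $$[f_1,f_2]_{x,C}\cdot[f_1,f_2]_{C,x}=1 .$$ -/

import Mathlib

universe u

open AlgebraicGeometry CategoryTheory
open scoped Pointwise

namespace ArithSurface

section Numerations

variable {R V : Type*} [CommRing R] [AddCommGroup V] [Module R V]

/-- `L / C` is an `R`-lattice in the `R`-module `A / C`: it is finitely generated and the elements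
of `A / L` are killed by powers of the ideal `𝔪`. Here `R` will be a complete two-dimensional local
ring with maximal ideal `𝔪` and finite residue field and `A / C` a module of finite length over a
product of one-dimensional local fields; the lattices are then a fundamental system of compact
open subgroups of the locally compact group `A / C`. -/
structure IsLattice (𝔪 : Ideal R) (A C L : Submodule R V) : Prop where
  le_left : C ≤ L
  le_right : L ≤ A
  fg : ∃ M : Submodule R V, M.FG ∧ L = C ⊔ M
  torsion : ∀ a ∈ A, ∃ n : ℕ, ∀ r ∈ 𝔪 ^ n, r • a ∈ L

/-- The compact open subgroups of the locally compact group `A / C`, written as subgroups `U` of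
`V` between `C` and `A`: the subgroups that contain a lattice and are contained in a lattice. -/
def IsCompactOpen (𝔪 : Ideal R) (A C : Submodule R V) (U : AddSubgroup V) : Prop :=
  ∃ L L' : Submodule R V, IsLattice 𝔪 A C L ∧ IsLattice 𝔪 A C L' ∧
    L.toAddSubgroup ≤ U ∧ U ≤ L'.toAddSubgroup

/-- The `ℝ`-torsor `Num (A / C)` of numerations of `A / C`: real functions on the set of compact
open subgroups that increase by `log [U' : U]` from `U` to `U'`, that is, logarithms of Haar
measures of `A / C`. -/
@[ext]
structure Num (𝔪 : Ideal R) (A C : Submodule R V) where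
  val : ∀ U : AddSubgroup V, IsCompactOpen 𝔪 A C U → ℝ
  rule : ∀ U U' hU hU', U ≤ U' → val U' hU' = val U hU + Real.log (U.relIndex U')

/-- The action of `ℝ` on numerations by translation. -/
instance (𝔪 : Ideal R) (A C : Submodule R V) : VAdd ℝ (Num 𝔪 A C) where
  vadd r n := ⟨fun U hU => r + n.val U hU, fun U U' hU hU' h => by rw [n.rule U U' hU hU' h]; ring⟩

/-- The family `Λ` of submodules is a two-dimensional (ind-pro) system: it is directed downwards,
the quotients `A / C` have compact open subgroups, any two of them are commensurable, and a compact
open subgroup of `A / C'` induces a compact open subgroup of `C / C'`. -/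
structure IsNumerable (𝔪 : Ideal R) (Λ : Set (Submodule R V)) : Prop where
  directed : ∀ A A' : Λ, ∃ C : Λ, C ≤ A ∧ C ≤ A'
  exists_isCompactOpen : ∀ A C : Λ, C ≤ A → ∃ U, IsCompactOpen 𝔪 (A : Submodule R V) C U
  relIndex_ne_zero : ∀ A C : Λ, C ≤ A → ∀ U U', IsCompactOpen 𝔪 (A : Submodule R V) C U →
    IsCompactOpen 𝔪 (A : Submodule R V) C U' → U ≤ U' → U.relIndex U' ≠ 0
  inter : ∀ A C C' : Λ, C' ≤ C → C ≤ A → ∀ U, IsCompactOpen 𝔪 (A : Submodule R V) C' U →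
    IsCompactOpen 𝔪 (C : Submodule R V) C' (U ⊓ (C : Submodule R V).toAddSubgroup)

variable {𝔪 : Ideal R} {A A' A'' C C' C'' : Submodule R V}

theorem Num.vadd_val (r : ℝ) (n : Num 𝔪 A C) (U hU) : (r +ᵥ n).val U hU = r + n.val U hU := rfl

theorem IsLattice.sup {L L' : Submodule R V} (h : IsLattice 𝔪 A C L) (h' : IsLattice 𝔪 A C L') :
    IsLattice 𝔪 A C (L ⊔ L') := by
  obtain ⟨M, hM, e⟩ := h.fg
  obtain ⟨M', hM', e'⟩ := h'.fg
  refine ⟨h.le_left.trans le_sup_left, sup_le h.le_right h'.le_right, ⟨M ⊔ M', hM.sup hM', ?_⟩, ?_⟩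
  · rw [e, e', sup_sup_sup_comm, sup_idem]
  · intro a ha
    obtain ⟨n, hn⟩ := h.torsion a ha
    exact ⟨n, fun r hr => (le_sup_left : L ≤ L ⊔ L') (hn r hr)⟩

theorem IsCompactOpen.sup {U U' : AddSubgroup V} (h : IsCompactOpen 𝔪 A C U)
    (h' : IsCompactOpen 𝔪 A C U') : IsCompactOpen 𝔪 A C (U ⊔ U') := by
  obtain ⟨L, L', hL, hL', h1, h2⟩ := h
  obtain ⟨P, P', hP, hP', h3, h4⟩ := h'
  refine ⟨L, L' ⊔ P', hL, hL'.sup hP', h1.trans le_sup_left, ?_⟩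
  rw [Submodule.sup_toAddSubgroup]
  exact sup_le_sup h2 h4

/-- The image of a compact open subgroup of `A / C'` in `A / C` is compact open. -/
theorem IsCompactOpen.image {U : AddSubgroup V} (hC : C' ≤ C) (hA : C ≤ A)
    (h : IsCompactOpen 𝔪 A C' U) : IsCompactOpen 𝔪 A C (U ⊔ C.toAddSubgroup) := by
  have key : ∀ L, IsLattice 𝔪 A C' L → IsLattice 𝔪 A C (L ⊔ C) := by
    intro L hL
    obtain ⟨M, hM, e⟩ := hL.fg
    refine ⟨le_sup_right, sup_le hL.le_right hA, ⟨M, hM, ?_⟩, ?_⟩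
    · rw [e, sup_comm, ← sup_assoc, sup_eq_left.2 hC]
    · intro a ha
      obtain ⟨n, hn⟩ := hL.torsion a ha
      exact ⟨n, fun r hr => (le_sup_left : L ≤ L ⊔ C) (hn r hr)⟩
  obtain ⟨L, L', hL, hL', h1, h2⟩ := h
  refine ⟨_, _, key L hL, key L' hL', ?_, ?_⟩ <;> rw [Submodule.sup_toAddSubgroup]
  · exact sup_le_sup_right h1 _
  · exact sup_le_sup_right h2 _

theorem IsCompactOpen.left_le {U : AddSubgroup V} (h : IsCompactOpen 𝔪 A C U) :
    C.toAddSubgroup ≤ U := by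
  obtain ⟨L, L', hL, hL', h1, h2⟩ := h
  exact le_trans hL.le_left h1

theorem IsCompactOpen.le_right {U : AddSubgroup V} (h : IsCompactOpen 𝔪 A C U) :
    U ≤ A.toAddSubgroup := by
  obtain ⟨L, L', hL, hL', h1, h2⟩ := h
  exact le_trans h2 hL'.le_right

theorem log_relIndex_trans {U W X : AddSubgroup V} (h1 : U ≤ W) (h2 : W ≤ X)
    (h : U.relIndex X ≠ 0) :
    Real.log (U.relIndex X) = Real.log (U.relIndex W) + Real.log (W.relIndex X) := by
  rw [← AddSubgroup.relIndex_mul_relIndex U W X h1 h2] at h ⊢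
  rw [Nat.cast_mul, Real.log_mul]
  · exact_mod_cast left_ne_zero_of_mul h
  · exact_mod_cast right_ne_zero_of_mul h


theorem log_relIndex_sup_inf {U U' : AddSubgroup V} (D : AddSubgroup V) (h : U ≤ U')
    (f : U.relIndex U' ≠ 0) : Real.log (U.relIndex U') =
      Real.log ((U ⊔ D).relIndex (U' ⊔ D)) + Real.log ((U ⊓ D).relIndex (U' ⊓ D)) := by
  rw [log_relIndex_trans (U := U) (W := U ⊔ (U' ⊓ D)) (X := U') le_sup_left
    (sup_le h inf_le_left) f]
  have e1 : U.relIndex (U ⊔ (U' ⊓ D)) = (U ⊓ D).relIndex (U' ⊓ D) := by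
    rw [AddSubgroup.relIndex_sup_left, ← AddSubgroup.inf_relIndex_right U,
      ← inf_assoc, inf_eq_left.2 h]
  have e2 : (U ⊔ (U' ⊓ D)).relIndex U' = (U ⊔ D).relIndex (U' ⊔ D) := by
    have : U' ⊔ D = (U ⊔ D) ⊔ U' := by
      rw [sup_right_comm, sup_eq_right.2 h]
    rw [this, AddSubgroup.relIndex_sup_left, ← AddSubgroup.inf_relIndex_right (U ⊔ D),
      sup_inf_assoc_of_le _ h, inf_comm D]
  rw [e1, e2, add_comm]

theorem Num.vadd_vadd (r s : ℝ) (n : Num 𝔪 A C) : r +ᵥ (s +ᵥ n) = (r + s) +ᵥ n :=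
  Num.ext (by funext U hU; simp only [Num.vadd_val]; ring)

theorem Num.zero_vadd' (n : Num 𝔪 A C) : (0 : ℝ) +ᵥ n = n :=
  Num.ext (by funext U hU; simp only [Num.vadd_val]; ring)

end Numerations

section RelDim

variable {R V : Type*} [CommRing R] [AddCommGroup V] [Module R V] {𝔪 : Ideal R}
  {Λ : Set (Submodule R V)} {A A' A'' C C' C'' : Λ}

namespace IsNumerable

/-- Two numerations of the same quotient differ by a constant. -/
theorem exists_vadd (T : IsNumerable 𝔪 Λ) (hCA : C ≤ A)
    (n n' : Num 𝔪 (A : Submodule R V) C) : ∃ r : ℝ, n' = r +ᵥ n := by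
  obtain ⟨U, hU⟩ := T.exists_isCompactOpen A C hCA
  refine ⟨n'.val U hU - n.val U hU, Num.ext ?_⟩
  funext W hW
  rw [Num.vadd_val]
  have a := n.rule W (U ⊔ W) hW (hU.sup hW) le_sup_right
  have b := n.rule U (U ⊔ W) hU (hU.sup hW) le_sup_left
  have c := n'.rule W (U ⊔ W) hW (hU.sup hW) le_sup_right
  have d := n'.rule U (U ⊔ W) hU (hU.sup hW) le_sup_left
  linarith

theorem nonempty (T : IsNumerable 𝔪 Λ) (hCA : C ≤ A) : Nonempty (Num 𝔪 (A : Submodule R V) C) := by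
  obtain ⟨O, hO⟩ := T.exists_isCompactOpen A C hCA
  refine ⟨⟨fun U _ => Real.log (O.relIndex (U ⊔ O)) - Real.log (U.relIndex (U ⊔ O)), ?_⟩⟩
  intro U U' hU hU' h
  have f := T.relIndex_ne_zero A C hCA
  have h' : U ⊔ O ≤ U' ⊔ O := sup_le_sup_right h _
  have e1 := log_relIndex_trans (le_sup_right : O ≤ U ⊔ O) h'
    (f _ _ hO (hU'.sup hO) le_sup_right)
  have e2 := log_relIndex_trans (le_sup_left : U ≤ U ⊔ O) h'
    (f _ _ hU (hU'.sup hO) (le_sup_left.trans h'))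
  have e3 := log_relIndex_trans h (le_sup_left : U' ≤ U' ⊔ O)
    (f _ _ hU (hU'.sup hO) (le_sup_left.trans h'))
  linarith

theorem vadd_inj (T : IsNumerable 𝔪 Λ) (hCA : C ≤ A)
    {n : Num 𝔪 (A : Submodule R V) C} {r s : ℝ} (h : r +ᵥ n = s +ᵥ n) : r = s := by
  obtain ⟨U, hU⟩ := T.exists_isCompactOpen A C hCA
  have := congrArg (fun n => n.val U hU) h
  simpa [Num.vadd_val] using this

/-- The isomorphism `Num (A / C) ⊗ Num (C / C') ≅ Num (A / C')` attached to the exact sequence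
`0 → C / C' → A / C' → A / C → 0`, on pure tensors: the number of `U` is the number of its image
in `A / C` plus the number of its intersection with `C / C'`. -/
def concat (T : IsNumerable 𝔪 Λ) (h' : C' ≤ C) (h : C ≤ A)
    (n : Num 𝔪 (A : Submodule R V) C) (m : Num 𝔪 (C : Submodule R V) C') :
    Num 𝔪 (A : Submodule R V) C' where
  val U hU := n.val (U ⊔ (C : Submodule R V).toAddSubgroup) (hU.image h' h) +
    m.val (U ⊓ (C : Submodule R V).toAddSubgroup) (T.inter A C C' h' h U hU)
  rule U U' hU hU' hUU' := by
    rw [n.rule _ _ (hU.image h' h) (hU'.image h' h) (sup_le_sup_right hUU' _),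
      m.rule _ _ (T.inter A C C' h' h U hU) (T.inter A C C' h' h U' hU')
        (inf_le_inf_right _ hUU')]
    have f := T.relIndex_ne_zero A C' (h'.trans h) U U' hU hU' hUU'
    rw [log_relIndex_sup_inf (C : Submodule R V).toAddSubgroup hUU' f]
    ring

theorem concat_vadd_left (T : IsNumerable 𝔪 Λ) (h' : C' ≤ C) (h : C ≤ A) (r : ℝ)
    (n : Num 𝔪 (A : Submodule R V) C) (m : Num 𝔪 (C : Submodule R V) C') :
    T.concat h' h (r +ᵥ n) m = r +ᵥ T.concat h' h n m :=
  Num.ext (by funext U hU; simp only [Num.vadd_val, concat]; ring)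

theorem concat_vadd_right (T : IsNumerable 𝔪 Λ) (h' : C' ≤ C) (h : C ≤ A) (r : ℝ)
    (n : Num 𝔪 (A : Submodule R V) C) (m : Num 𝔪 (C : Submodule R V) C') :
    T.concat h' h n (r +ᵥ m) = r +ᵥ T.concat h' h n m :=
  Num.ext (by funext U hU; simp only [Num.vadd_val, concat]; ring)

theorem concat_assoc (T : IsNumerable 𝔪 Λ) (h'' : C'' ≤ C') (h' : C' ≤ C) (h : C ≤ A)
    (n : Num 𝔪 (A : Submodule R V) C) (m : Num 𝔪 (C : Submodule R V) C')
    (l : Num 𝔪 (C' : Submodule R V) C'') :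
    T.concat h'' (h'.trans h) (T.concat h' h n m) l =
      T.concat (h''.trans h') h n (T.concat h'' h' m l) := by
  refine Num.ext ?_
  funext U hU
  have hc : (C' : Submodule R V).toAddSubgroup ≤ (C : Submodule R V).toAddSubgroup := h'
  have e1 : U ⊔ (C' : Submodule R V).toAddSubgroup ⊔ (C : Submodule R V).toAddSubgroup =
      U ⊔ (C : Submodule R V).toAddSubgroup := by rw [sup_assoc, sup_eq_right.2 hc]
  have e2 : (U ⊔ (C' : Submodule R V).toAddSubgroup) ⊓ (C : Submodule R V).toAddSubgroup =
      U ⊓ (C : Submodule R V).toAddSubgroup ⊔ (C' : Submodule R V).toAddSubgroup := by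
    rw [sup_comm, sup_inf_assoc_of_le _ hc, sup_comm]
  have e3 : U ⊓ (C : Submodule R V).toAddSubgroup ⊓ (C' : Submodule R V).toAddSubgroup =
      U ⊓ (C' : Submodule R V).toAddSubgroup := by rw [inf_assoc, inf_eq_right.2 hc]
  simp only [concat, e1, e2, e3]
  ring

theorem concat_left_inj (T : IsNumerable 𝔪 Λ) (h' : C' ≤ C) (h : C ≤ A)
    {n n' : Num 𝔪 (A : Submodule R V) C} {m : Num 𝔪 (C : Submodule R V) C'}
    (e : T.concat h' h n m = T.concat h' h n' m) : n = n' := by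
  obtain ⟨r, rfl⟩ := T.exists_vadd h n n'
  rw [concat_vadd_left] at e
  have : (0 : ℝ) = r := T.vadd_inj (h'.trans h) (by rw [Num.zero_vadd']; exact e)
  rw [← this, Num.zero_vadd']

/-- Every numeration of `A / C'` is obtained from a given numeration of `C / C'`. -/
theorem exists_concat (T : IsNumerable 𝔪 Λ) (h' : C' ≤ C) (h : C ≤ A)
    (N : Num 𝔪 (A : Submodule R V) C') (m : Num 𝔪 (C : Submodule R V) C') :
    ∃ n, T.concat h' h n m = N := by
  obtain ⟨n⟩ := T.nonempty h
  obtain ⟨r, rfl⟩ := T.exists_vadd (h'.trans h) (T.concat h' h n m) N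
  exact ⟨r +ᵥ n, concat_vadd_left ..⟩

end IsNumerable

/-- The `ℝ`-torsor `[A | A']₂`: the projective limit, over the `C ∈ Λ` contained in `A ∩ A'`, of
the `ℝ`-torsors `Hom_ℝ (Num (A / C), Num (A' / C))`, the transition map for `C' ⊆ C` being induced by
`Num (A / C') = Num (A / C) ⊗ Num (C / C')` and `Num (A' / C') = Num (A' / C) ⊗ Num (C / C')`. -/
@[ext]
structure RelDim (T : IsNumerable 𝔪 Λ) (A A' : Λ) where
  hom : ∀ C : Λ, C ≤ A → C ≤ A' → Num 𝔪 (A : Submodule R V) C → Num 𝔪 (A' : Submodule R V) C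
  hom_vadd : ∀ C h h' (r : ℝ) n, hom C h h' (r +ᵥ n) = r +ᵥ hom C h h' n
  compat : ∀ C C' (hC : C' ≤ C) (h : C ≤ A) (h' : C ≤ A') n (m : Num 𝔪 (C : Submodule R V) C'),
    hom C' (hC.trans h) (hC.trans h') (T.concat hC h n m) = T.concat hC h' (hom C h h' n) m

namespace RelDim

variable {T : IsNumerable 𝔪 Λ}

theorem eq_of_le {α β : RelDim T A A'} (C : Λ) (h : C ≤ A) (h' : C ≤ A') (C' : Λ) (hC : C' ≤ C)
    (e : α.hom C' (hC.trans h) (hC.trans h') = β.hom C' (hC.trans h) (hC.trans h')) :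
    α.hom C h h' = β.hom C h h' := by
  funext n
  obtain ⟨m⟩ := T.nonempty hC
  apply T.concat_left_inj hC h' (m := m)
  rw [← α.compat, ← β.compat, e]

theorem le_of_eq {α β : RelDim T A A'} (C : Λ) (h : C ≤ A) (h' : C ≤ A') (C' : Λ) (hC : C' ≤ C)
    (e : α.hom C h h' = β.hom C h h') :
    α.hom C' (hC.trans h) (hC.trans h') = β.hom C' (hC.trans h) (hC.trans h') := by
  funext N
  obtain ⟨m⟩ := T.nonempty hC
  obtain ⟨n, rfl⟩ := T.exists_concat hC h N m
  rw [α.compat, β.compat, e]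

/-- An element of the limit is determined by any one of its components. -/
theorem ext_of {α β : RelDim T A A'} (C : Λ) (h : C ≤ A) (h' : C ≤ A')
    (e : α.hom C h h' = β.hom C h h') : α = β := by
  apply RelDim.ext
  funext D hD hD'
  obtain ⟨E, hE, hE'⟩ := T.directed C D
  exact eq_of_le D hD hD' E hE' (le_of_eq C h h' E hE e)

/-- Every component of the limit can be prescribed. -/
theorem exists_of (C : Λ) (h : C ≤ A) (h' : C ≤ A')
    (φ : Num 𝔪 (A : Submodule R V) C → Num 𝔪 (A' : Submodule R V) C)
    (hφ : ∀ (r : ℝ) n, φ (r +ᵥ n) = r +ᵥ φ n) :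
    ∃ α : RelDim T A A', α.hom C h h' = φ := by
  -- the relation between components at `D` and at `C`
  have key : ∀ (D : Λ) (hD : D ≤ A) (hD' : D ≤ A') (n : Num 𝔪 (A : Submodule R V) D),
      ∃ n' : Num 𝔪 (A' : Submodule R V) D, ∀ (E : Λ) (hE : E ≤ C) (hE' : E ≤ D)
        (n₀ : Num 𝔪 (A : Submodule R V) C) (m₀ : Num 𝔪 (C : Submodule R V) E)
        (m : Num 𝔪 (D : Submodule R V) E), T.concat hE h n₀ m₀ = T.concat hE' hD n m →
        T.concat hE h' (φ n₀) m₀ = T.concat hE' hD' n' m := by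
    intro D hD hD' n
    obtain ⟨E, hE, hE'⟩ := T.directed C D
    obtain ⟨m₀⟩ := T.nonempty hE
    obtain ⟨m⟩ := T.nonempty hE'
    obtain ⟨n₀, e₀⟩ := T.exists_concat hE h (T.concat hE' hD n m) m₀
    obtain ⟨n', e'⟩ := T.exists_concat hE' hD' (T.concat hE h' (φ n₀) m₀) m
    refine ⟨n', ?_⟩
    -- the same subgroup `E`
    have same : ∀ (x₀ : Num 𝔪 (A : Submodule R V) C) (y₀ : Num 𝔪 (C : Submodule R V) E)
        (y : Num 𝔪 (D : Submodule R V) E), T.concat hE h x₀ y₀ = T.concat hE' hD n y →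
        T.concat hE h' (φ x₀) y₀ = T.concat hE' hD' n' y := by
      intro x₀ y₀ y e
      obtain ⟨a, rfl⟩ := T.exists_vadd h n₀ x₀
      obtain ⟨b, rfl⟩ := T.exists_vadd hE m₀ y₀
      obtain ⟨c, rfl⟩ := T.exists_vadd hE' m y
      rw [T.concat_vadd_right, T.concat_vadd_right, T.concat_vadd_left, e₀, Num.vadd_vadd] at e
      have e3 := T.vadd_inj (hE'.trans hD) e
      rw [T.concat_vadd_right, T.concat_vadd_right, hφ, T.concat_vadd_left, e', Num.vadd_vadd, e3]
    intro F hF hF' x₀ y₀ y e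
    obtain ⟨G, hG, hG'⟩ := T.directed E F
    obtain ⟨z⟩ := T.nonempty hG'
    obtain ⟨w⟩ := T.nonempty hG
    obtain ⟨u₀, f₀⟩ := T.exists_concat hG hE (T.concat hG' hF y₀ z) w
    obtain ⟨u, f⟩ := T.exists_concat hG hE' (T.concat hG' hF' y z) w
    have e1 : T.concat hE h x₀ u₀ = T.concat hE' hD n u := by
      apply T.concat_left_inj hG (hE.trans h) (m := w)
      rw [T.concat_assoc, f₀, ← T.concat_assoc, e, T.concat_assoc, ← f, ← T.concat_assoc]
    have e2 := same x₀ u₀ u e1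
    apply T.concat_left_inj hG' (hF.trans h') (m := z)
    rw [T.concat_assoc, ← f₀, ← T.concat_assoc, e2, T.concat_assoc, f, ← T.concat_assoc]
  choose ψ hψ using key
  have uniq : ∀ (D : Λ) (hD : D ≤ A) (hD' : D ≤ A') (n : Num 𝔪 (A : Submodule R V) D)
      (n' : Num 𝔪 (A' : Submodule R V) D) (E : Λ) (hE : E ≤ C) (hE' : E ≤ D)
        (n₀ : Num 𝔪 (A : Submodule R V) C) (m₀ : Num 𝔪 (C : Submodule R V) E)
        (m : Num 𝔪 (D : Submodule R V) E), T.concat hE h n₀ m₀ = T.concat hE' hD n m →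
        T.concat hE h' (φ n₀) m₀ = T.concat hE' hD' n' m → ψ D hD hD' n = n' := by
    intro D hD hD' n n' E hE hE' n₀ m₀ m e e'
    apply T.concat_left_inj hE' hD' (m := m)
    rw [← e', hψ D hD hD' n E hE hE' n₀ m₀ m e]
  refine ⟨⟨ψ, ?_, ?_⟩, ?_⟩
  · intro D hD hD' r n
    obtain ⟨E, hE, hE'⟩ := T.directed C D
    obtain ⟨m₀⟩ := T.nonempty hE
    obtain ⟨m⟩ := T.nonempty hE'
    obtain ⟨n₀, e₀⟩ := T.exists_concat hE h (T.concat hE' hD n m) m₀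
    refine uniq D hD hD' _ _ E hE hE' (r +ᵥ n₀) m₀ m ?_ ?_
    · rw [T.concat_vadd_left, T.concat_vadd_left, e₀]
    · rw [hφ, T.concat_vadd_left, T.concat_vadd_left, hψ D hD hD' n E hE hE' n₀ m₀ m e₀]
  · intro D D' hDD hD hD' n m
    obtain ⟨E, hE, hE'⟩ := T.directed C D'
    obtain ⟨m₀⟩ := T.nonempty hE
    obtain ⟨l⟩ := T.nonempty hE'
    obtain ⟨n₀, e₀⟩ := T.exists_concat hE h
      (T.concat hE' (hDD.trans hD) (T.concat hDD hD n m) l) m₀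
    refine uniq D' (hDD.trans hD) (hDD.trans hD') _ _ E hE hE' n₀ m₀ l e₀ ?_
    rw [T.concat_assoc] at e₀ ⊢
    exact hψ D hD hD' n E hE (hE'.trans hDD) n₀ m₀ _ e₀
  · funext n
    obtain ⟨E, hE, -⟩ := T.directed C C
    obtain ⟨m⟩ := T.nonempty hE
    exact uniq C h h' n _ E hE hE n m m rfl rfl

theorem exists_comp (α : RelDim T A A') (β : RelDim T A' A'') :
    ∃ γ : RelDim T A A'', ∀ (C : Λ) (h : C ≤ A) (h' : C ≤ A') (h'' : C ≤ A'') (n),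
      γ.hom C h h'' n = β.hom C h' h'' (α.hom C h h' n) := by
  obtain ⟨B, hB, hB'⟩ := T.directed A A'
  obtain ⟨C, hC, hC'⟩ := T.directed B A''
  obtain ⟨γ, hγ⟩ := exists_of (T := T) (A := A) (A' := A'') C (hC.trans hB) hC'
    (fun n => β.hom C (hC.trans hB') hC' (α.hom C (hC.trans hB) (hC.trans hB') n))
    (fun r n => by rw [α.hom_vadd, β.hom_vadd])
  refine ⟨γ, fun D hD hD' hD'' n => ?_⟩
  obtain ⟨E, hE, hE'⟩ := T.directed C D
  obtain ⟨m⟩ := T.nonempty hE'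
  obtain ⟨m₀⟩ := T.nonempty hE
  obtain ⟨n₀, e⟩ := T.exists_concat hE (hC.trans hB) (T.concat hE' hD n m) m₀
  apply T.concat_left_inj hE' hD'' (m := m)
  rw [← γ.compat, ← β.compat, ← α.compat, ← e, γ.compat, hγ, α.compat, β.compat]

/-- The composition `[A | A']₂ × [A' | A'']₂ → [A | A'']₂`; it is characterized by `comp_hom`. -/
noncomputable def comp (α : RelDim T A A') (β : RelDim T A' A'') : RelDim T A A'' :=
  (exists_comp α β).choose

theorem comp_hom (α : RelDim T A A') (β : RelDim T A' A'') (C : Λ) (h : C ≤ A) (h' : C ≤ A')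
    (h'' : C ≤ A'') (n) : (comp α β).hom C h h'' n = β.hom C h' h'' (α.hom C h h' n) :=
  (exists_comp α β).choose_spec C h h' h'' n

/-- The element of `[A | A]₂ = ℝ` given by the real number `r`. -/
def scalar (T : IsNumerable 𝔪 Λ) (A : Λ) (r : ℝ) : RelDim T A A where
  hom _ _ _ n := r +ᵥ n
  hom_vadd C h h' s n := by rw [Num.vadd_vadd, Num.vadd_vadd, add_comm]
  compat C C' hC h h' n m := by rw [T.concat_vadd_left]

end RelDim

end RelDim

section Extension

variable {R V G : Type*} [CommRing R] [AddCommGroup V] [Module R V] {𝔪 : Ideal R}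
  [Group G] [DistribMulAction G V] [SMulCommClass G R V]

theorem IsLattice.smul (g : G) {A C L : Submodule R V} (h : IsLattice 𝔪 A C L) :
    IsLattice 𝔪 (g • A) (g • C) (g • L) := by
  obtain ⟨M, hM, e⟩ := h.fg
  refine ⟨smul_mono_right g h.le_left, smul_mono_right g h.le_right, ⟨g • M, ?_, ?_⟩, ?_⟩
  · exact hM.map _
  · rw [e, Submodule.smul_sup']
  · rintro _ ⟨a, ha, rfl⟩
    obtain ⟨n, hn⟩ := h.torsion a ha
    refine ⟨n, fun r hr => ?_⟩
    have := Submodule.smul_mem_pointwise_smul _ g _ (hn r hr)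
    rwa [smul_comm] at this

theorem smul_addSubgroup_mono (g : G) {U W : AddSubgroup V} (h : U ≤ W) : g • U ≤ g • W :=
  AddSubgroup.map_mono h

theorem IsCompactOpen.smul (g : G) {A C : Submodule R V} {U : AddSubgroup V}
    (h : IsCompactOpen 𝔪 A C U) : IsCompactOpen 𝔪 (g • A) (g • C) (g • U) := by
  obtain ⟨L, L', hL, hL', h1, h2⟩ := h
  exact ⟨g • L, g • L', hL.smul g, hL'.smul g, smul_addSubgroup_mono g h1,
    smul_addSubgroup_mono g h2⟩

theorem smul_addSubgroup_inf (g : G) (U W : AddSubgroup V) : g • (U ⊓ W) = g • U ⊓ g • W :=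
  SetLike.coe_injective (Set.smul_set_inter)

theorem smul_addSubgroup_sup (g : G) (U W : AddSubgroup V) : g • (U ⊔ W) = g • U ⊔ g • W :=
  AddSubgroup.map_sup _ _ _

theorem relIndex_smul (g : G) (U W : AddSubgroup V) : (g • U).relIndex (g • W) = U.relIndex W :=
  AddSubgroup.relIndex_map_map_of_injective U W (MulAction.injective g)

theorem Num.val_congr {A C : Submodule R V} (n : Num 𝔪 A C) {U U' : AddSubgroup V} (e : U = U')
    (hU hU') : n.val U hU = n.val U' hU' := by subst e; rfl

/-- The transport `Num (A / C) → Num (g A / g C)` of numerations by `g`. -/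
def Num.move (g : G) {A C X Y : Submodule R V} (hA : g • A = X) (hC : g • C = Y)
    (n : Num 𝔪 A C) : Num 𝔪 X Y where
  val U hU := n.val (g⁻¹ • U) (by
    rw [← inv_smul_eq_iff.2 hA.symm, ← inv_smul_eq_iff.2 hC.symm]; exact hU.smul g⁻¹)
  rule U U' hU hU' h := by
    rw [n.rule (g⁻¹ • U) (g⁻¹ • U') _ _ (smul_addSubgroup_mono g⁻¹ h), relIndex_smul]

theorem Num.move_vadd (g : G) {A C X Y : Submodule R V} (hA : g • A = X) (hC : g • C = Y) (r : ℝ)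
    (n : Num 𝔪 A C) : (r +ᵥ n).move g hA hC = r +ᵥ n.move g hA hC := rfl

theorem Num.move_move (g h : G) {A C X Y Z W : Submodule R V} (hA : g • A = X) (hC : g • C = Y)
    (hX : h • X = Z) (hY : h • Y = W) (hA' : (h * g) • A = Z) (hC' : (h * g) • C = W)
    (n : Num 𝔪 A C) : (n.move g hA hC).move h hX hY = n.move (h * g) hA' hC' :=
  Num.ext (by funext U hU; exact n.val_congr (by rw [mul_inv_rev, mul_smul]) _ _)

theorem Num.move_one {A C : Submodule R V} (hA : (1 : G) • A = A) (hC : (1 : G) • C = C)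
    (n : Num 𝔪 A C) : n.move (1 : G) hA hC = n :=
  Num.ext (by funext U hU; exact n.val_congr (by rw [inv_one, one_smul]) _ _)

variable {A₀ : Submodule R V} {A A' A'' B B' B'' C : MulAction.orbit G A₀}

theorem orbit_coe {g : G} (h : g • A = B) : g • (A : Submodule R V) = B :=
  congrArg Subtype.val h

theorem IsNumerable.move_concat (T : IsNumerable 𝔪 (MulAction.orbit G A₀)) (g : G)
    {D E X Y Z : MulAction.orbit G A₀} (hX : g • C = X) (hY : g • D = Y) (hZ : g • E = Z)
    (h' : E ≤ D) (h : D ≤ C) (k' : Z ≤ Y) (k : Y ≤ X)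
    (n : Num 𝔪 (C : Submodule R V) D) (m : Num 𝔪 (D : Submodule R V) E) :
    (T.concat h' h n m).move g (orbit_coe hX) (orbit_coe hZ) =
      T.concat k' k (n.move g (orbit_coe hX) (orbit_coe hY))
        (m.move g (orbit_coe hY) (orbit_coe hZ)) := by
  have e : g⁻¹ • (Y : Submodule R V).toAddSubgroup = (D : Submodule R V).toAddSubgroup := by
    rw [← hY]; exact inv_smul_smul g (D : Submodule R V).toAddSubgroup
  refine Num.ext ?_
  funext U hU
  refine congrArg₂ _ (n.val_congr ?_ _ _) (m.val_congr ?_ _ _)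
  · rw [smul_addSubgroup_sup, e]
  · rw [smul_addSubgroup_inf, e]

theorem orbit_smul_le {A C : MulAction.orbit G A₀} (g : G) (h : C ≤ A) : g • C ≤ g • A :=
  Submodule.map_mono h

theorem orbit_inv_smul_le {A C X : MulAction.orbit G A₀} {g : G} (hA : g • A = X) (h : C ≤ X) :
    g⁻¹ • C ≤ A := by
  rw [← inv_smul_eq_iff.2 hA.symm]; exact orbit_smul_le _ h

namespace RelDim

variable {T : IsNumerable 𝔪 (MulAction.orbit G A₀)}

/-- The transport `α ↦ g(α)` from `[A | A']₂` to `[g A | g A']₂`. -/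
def move (g : G) (hA : g • A = B) (hA' : g • A' = B') (α : RelDim T A A') : RelDim T B B' where
  hom C h h' n :=
    (α.hom (g⁻¹ • C) (orbit_inv_smul_le hA h) (orbit_inv_smul_le hA' h')
      (n.move g⁻¹ (orbit_coe (inv_smul_eq_iff.2 hA.symm)) (orbit_coe rfl))).move g
      (orbit_coe hA') (orbit_coe (smul_inv_smul g C))
  hom_vadd C h h' r n := by rw [Num.move_vadd, α.hom_vadd, Num.move_vadd]
  compat C C' hC h h' n m := by
    rw [T.move_concat g⁻¹ (inv_smul_eq_iff.2 hA.symm) rfl rfl hC h (orbit_smul_le g⁻¹ hC)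
        (orbit_inv_smul_le hA h), α.compat _ _ _ _ (orbit_inv_smul_le hA' h'),
      T.move_concat g hA' (smul_inv_smul g C) (smul_inv_smul g C') _ _ hC h',
      Num.move_move g⁻¹ g (orbit_coe rfl) (orbit_coe rfl) _ _ (by rw [mul_inv_cancel, one_smul])
        (by rw [mul_inv_cancel, one_smul])]
    congr 1
    refine Num.ext ?_
    funext U hU
    exact m.val_congr (by simp) _ _

theorem move_hom (g : G) (hA : g • A = B) (hA' : g • A' = B') (α : RelDim T A A')
    (C D : MulAction.orbit G A₀) (hD : g • C = D) (h : C ≤ A) (h' : C ≤ A') (k : D ≤ B)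
    (k' : D ≤ B') (n) :
    (α.move g hA hA').hom D k k' (n.move g (orbit_coe hA) (orbit_coe hD)) =
      (α.hom C h h' n).move g (orbit_coe hA') (orbit_coe hD) := by
  have key : ∀ (C' : MulAction.orbit G A₀) (e : C' = C) (k : C' ≤ A) (k' : C' ≤ A')
      (hD' : g • C' = D) (n' : Num 𝔪 (A : Submodule R V) C'),
      (∀ U hU hU', n'.val U hU = n.val U hU') →
      (α.hom C' k k' n').move g (orbit_coe hA') (orbit_coe hD') =
      (α.hom C h h' n).move g (orbit_coe hA') (orbit_coe hD) := by
    rintro C' rfl k k' hD' n' hn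
    have : n' = n := Num.ext (by funext U hU; exact hn U hU hU)
    rw [this]
  refine key (g⁻¹ • D) (inv_smul_eq_iff.2 hD.symm) _ _ (smul_inv_smul g D) _ ?_
  intro U hU hU'
  exact n.val_congr (by simp) _ _

theorem move_comp (g : G) (hA : g • A = B) (hA' : g • A' = B') (hA'' : g • A'' = B'')
    (α : RelDim T A A') (β : RelDim T A' A'') :
    (comp α β).move g hA hA'' = comp (α.move g hA hA') (β.move g hA' hA'') := by
  obtain ⟨D, hD, hD'⟩ := T.directed A A'
  obtain ⟨C, hC, hC'⟩ := T.directed D A''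
  subst hA hA' hA''
  have k := orbit_smul_le g (hC.trans hD)
  have k' := orbit_smul_le g (hC.trans hD')
  have k'' := orbit_smul_le g hC'
  refine ext_of (g • C) k k'' ?_
  funext n
  obtain ⟨n, rfl⟩ : ∃ n', n'.move g (orbit_coe rfl) (orbit_coe rfl) = n :=
    ⟨n.move g⁻¹ (orbit_coe (inv_smul_smul g A)) (orbit_coe (inv_smul_smul g C)),
      Num.ext (by funext U hU; exact n.val_congr (by simp) _ _)⟩
  rw [comp_hom _ _ _ k k' k'', move_hom g rfl rfl _ C _ rfl (hC.trans hD) hC',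
    move_hom g rfl rfl _ C _ rfl (hC.trans hD) (hC.trans hD'),
    move_hom g rfl rfl _ C _ rfl (hC.trans hD') hC', comp_hom]

theorem move_move (g h : G) (hA : g • A = B) (hA' : g • A' = B') {D D' : MulAction.orbit G A₀}
    (hB : h • B = D) (hB' : h • B' = D') (k : (h * g) • A = D) (k' : (h * g) • A' = D')
    (α : RelDim T A A') : (α.move g hA hA').move h hB hB' = α.move (h * g) k k' := by
  obtain ⟨C, hC, hC'⟩ := T.directed A A'
  subst hA hA' hB hB'
  have e : (h * g) • C = h • g • C := mul_smul h g C
  refine ext_of (h • g • C) (orbit_smul_le h (orbit_smul_le g hC))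
    (orbit_smul_le h (orbit_smul_le g hC')) ?_
  funext n
  obtain ⟨n, rfl⟩ : ∃ n', n'.move (h * g) (orbit_coe k) (orbit_coe e) = n :=
    ⟨n.move (h * g)⁻¹ (orbit_coe (inv_smul_eq_iff.2 k.symm)) (orbit_coe (inv_smul_eq_iff.2 e.symm)),
      Num.ext (by funext U hU; exact n.val_congr (by rw [inv_inv, smul_inv_smul]) _ _)⟩
  rw [move_hom (h * g) k k' α C _ e hC hC',
    ← Num.move_move g h (orbit_coe rfl) (orbit_coe rfl) (orbit_coe rfl) (orbit_coe rfl),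
    move_hom h rfl rfl _ (g • C) _ rfl (orbit_smul_le g hC) (orbit_smul_le g hC'),
    move_hom g rfl rfl α C _ rfl hC hC', Num.move_move]

end RelDim

end Extension

namespace RelDim

variable {R V : Type*} [CommRing R] [AddCommGroup V] [Module R V] {𝔪 : Ideal R}
  {Λ : Set (Submodule R V)} {A A' A'' A₃ : Λ} {T : IsNumerable 𝔪 Λ}

theorem exists_le₃ (T : IsNumerable 𝔪 Λ) (A A' A'' : Λ) : ∃ C, C ≤ A ∧ C ≤ A' ∧ C ≤ A'' := by
  obtain ⟨D, hD, hD'⟩ := T.directed A A'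
  obtain ⟨C, hC, hC'⟩ := T.directed D A''
  exact ⟨C, hC.trans hD, hC.trans hD', hC'⟩

theorem comp_assoc (α : RelDim T A A') (β : RelDim T A' A'') (γ : RelDim T A'' A₃) :
    comp (comp α β) γ = comp α (comp β γ) := by
  obtain ⟨D, h1, h2, h3⟩ := exists_le₃ T A A' A''
  obtain ⟨C, hC, h4⟩ := T.directed D A₃
  refine ext_of C (hC.trans h1) h4 ?_
  funext n
  rw [comp_hom _ _ C (hC.trans h1) (hC.trans h3) h4, comp_hom _ _ C _ (hC.trans h2) _,
    comp_hom _ _ C (hC.trans h1) (hC.trans h2) h4, comp_hom _ _ C (hC.trans h2) (hC.trans h3) h4]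

theorem hom_injective (α : RelDim T A A') (C : Λ) (h : C ≤ A) (h' : C ≤ A') :
    Function.Injective (α.hom C h h') := by
  intro n n' e
  obtain ⟨r, rfl⟩ := T.exists_vadd h n n'
  rw [α.hom_vadd] at e
  have : (0 : ℝ) = r := T.vadd_inj h' (by rw [Num.zero_vadd']; exact e)
  rw [← this, Num.zero_vadd']

theorem hom_surjective (α : RelDim T A A') (C : Λ) (h : C ≤ A) (h' : C ≤ A') :
    Function.Surjective (α.hom C h h') := by
  intro n'
  obtain ⟨n⟩ := T.nonempty h
  obtain ⟨r, e⟩ := T.exists_vadd h' (α.hom C h h' n) n'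
  exact ⟨r +ᵥ n, by rw [α.hom_vadd, e]⟩

theorem exists_inverse (α : RelDim T A A') : ∃ β : RelDim T A' A, comp β α = scalar T A' 0 := by
  obtain ⟨C, h, h'⟩ := T.directed A A'
  choose φ hφ using α.hom_surjective C h h'
  obtain ⟨β, hβ⟩ := exists_of (T := T) C h' h φ (fun r n => by
    apply α.hom_injective C h h'
    rw [hφ, α.hom_vadd, hφ])
  refine ⟨β, ext_of C h' h' ?_⟩
  funext n
  rw [comp_hom _ _ C h' h h', hβ, hφ]
  exact (Num.zero_vadd' n).symm

theorem exists_scalar (α : RelDim T A A) : ∃ r, α = scalar T A r := by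
  obtain ⟨n⟩ := T.nonempty (le_refl A)
  obtain ⟨r, e⟩ := T.exists_vadd le_rfl n (α.hom A le_rfl le_rfl n)
  refine ⟨r, ext_of A le_rfl le_rfl ?_⟩
  funext m
  obtain ⟨s, rfl⟩ := T.exists_vadd le_rfl n m
  rw [α.hom_vadd, e, (scalar T A r).hom_vadd]
  rfl

theorem nonempty (T : IsNumerable 𝔪 Λ) (A A' : Λ) : Nonempty (RelDim T A A') := by
  obtain ⟨C, h, h'⟩ := T.directed A A'
  obtain ⟨n⟩ := T.nonempty h
  obtain ⟨n'⟩ := T.nonempty h'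
  choose r hr using T.exists_vadd h n
  obtain ⟨α, -⟩ := exists_of (T := T) C h h' (fun m => r m +ᵥ n') (fun s m => by
    have : r (s +ᵥ m) = s + r m := by
      apply T.vadd_inj h (n := n)
      rw [← hr, ← Num.vadd_vadd, ← hr]
    rw [this, Num.vadd_vadd])
  exact ⟨α⟩

theorem scalar_injective {r s : ℝ} (e : scalar T A r = scalar T A s) : r = s := by
  obtain ⟨n⟩ := T.nonempty (le_refl A)
  exact T.vadd_inj le_rfl (congrFun (congrFun (congrFun (congrFun (congrArg hom e) A) le_rfl)
    le_rfl) n)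

theorem comp_scalar (r : ℝ) (α : RelDim T A A') :
    comp α (scalar T A' r) = comp (scalar T A r) α := by
  obtain ⟨C, h, h'⟩ := T.directed A A'
  refine ext_of C h h' ?_
  funext n
  rw [comp_hom _ _ C h h' h', comp_hom _ _ C h h h']
  exact (α.hom_vadd ..).symm

theorem scalar_comp_scalar (r s : ℝ) :
    comp (scalar T A r) (scalar T A s) = scalar T A (r + s) := by
  refine ext_of A le_rfl le_rfl ?_
  funext n
  rw [comp_hom _ _ A le_rfl le_rfl le_rfl]
  exact (Num.vadd_vadd ..).trans (by rw [add_comm]; rfl)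

theorem scalar_zero_comp (α : RelDim T A A') : comp (scalar T A 0) α = α := by
  obtain ⟨C, h, h'⟩ := T.directed A A'
  refine ext_of C h h' ?_
  funext n
  rw [comp_hom _ _ C h h h']
  exact congrArg _ (Num.zero_vadd' n)

/-- Transport of `[A | A']₂` along an equality `A' = A''`. -/
def castRight (e : A' = A'') (α : RelDim T A A') : RelDim T A A'' := e ▸ α

theorem castRight_rfl (α : RelDim T A A') : α.castRight rfl = α := rfl

theorem castRight_castRight (e : A' = A'') (e' : A'' = A₃) (α : RelDim T A A') :
    (α.castRight e).castRight e' = α.castRight (e.trans e') := by subst e e'; rfl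

theorem comp_castRight (e : A'' = A₃) (α : RelDim T A A') (β : RelDim T A' A'') :
    comp α (β.castRight e) = (comp α β).castRight e := by subst e; rfl

end RelDim

section CentralExtension

variable {R V G : Type*} [CommRing R] [AddCommGroup V] [Module R V] {𝔪 : Ideal R}
  [Group G] [DistribMulAction G V] [SMulCommClass G R V]

namespace RelDim

variable {A₀ : Submodule R V} {A A' A'' B B' B'' C : MulAction.orbit G A₀}
  {T : IsNumerable 𝔪 (MulAction.orbit G A₀)}

theorem castRight_move (g : G) (hA : g • A = B) (hA' : g • A' = B') (e : B' = B'')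
    (α : RelDim T A A') :
    (α.move g hA hA').castRight e = α.move g hA (hA'.trans e) := by subst e; rfl

theorem move_castRight (g : G) (hA : g • A = B) (hA' : g • A'' = B') (e : A' = A'')
    (α : RelDim T A A') :
    (α.castRight e).move g hA hA' = α.move g hA (by rw [e, hA']) := by subst e; rfl

theorem move_scalar (g : G) (hA : g • A = B) (hA' : g • A = B') (r : ℝ) :
    (scalar T A r).move g hA hA' = (scalar T B r).castRight (hA.symm.trans hA') := by
  subst hA hA'
  refine ext_of (g • A) le_rfl le_rfl ?_
  funext n
  refine Num.ext ?_
  funext U hU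
  exact congrArg (r + ·) (n.val_congr (by simp) _ _)

theorem move_one (h : (1 : G) • A = B) (h' : (1 : G) • A' = B') (e : B = A) (e' : A' = B')
    (α : RelDim T A A') : α.move (1 : G) h h' = e ▸ α.castRight e' := by
  subst e e'
  obtain ⟨C, k, k'⟩ := T.directed B A'
  refine ext_of C k k' ?_
  funext n
  have := move_hom (1 : G) h h' α C C (one_smul G C) k k' k k' n
  rwa [Num.move_one, Num.move_one] at this

end RelDim

variable {A₀ : Submodule R V}

/-- The family of all translates `g A₀`, `g ∈ G`. -/
abbrev translates (G : Type*) [Group G] [DistribMulAction G V] [SMulCommClass G R V]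
    (A₀ : Submodule R V) : Set (Submodule R V) := MulAction.orbit G A₀

/-- `A₀` as a member of the family of its translates. -/
def baseLattice (G : Type*) [Group G] [DistribMulAction G V] [SMulCommClass G R V]
    (A₀ : Submodule R V) : MulAction.orbit G A₀ := ⟨A₀, MulAction.mem_orbit_self A₀⟩

/-- The elements of the central extension of `G` attached to `A₀`: the pairs `(f, α)` with `f ∈ G`
and `α ∈ [A₀ | f A₀]₂`. -/
structure CentralExt (T : IsNumerable 𝔪 (MulAction.orbit G A₀)) where
  elt : G
  num : RelDim T (baseLattice G A₀) (elt • baseLattice G A₀)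

namespace CentralExt

open RelDim

variable {T : IsNumerable 𝔪 (MulAction.orbit G A₀)}

theorem ext' {p q : CentralExt T} (h : p.elt = q.elt)
    (h' : p.num.castRight (by rw [h]) = q.num) : p = q := by
  obtain ⟨f, α⟩ := p
  obtain ⟨g, β⟩ := q
  cases h
  cases h'
  rfl

/-- The group law `(f₁, α₁) ∘ (f₂, α₂) = (f₁ f₂, α₁ · f₁(α₂))`. -/
noncomputable instance : Mul (CentralExt T) where
  mul p q := ⟨p.elt * q.elt, comp p.num (q.num.move p.elt rfl (smul_smul p.elt q.elt _))⟩

/-- The central elements `(1, r)`, `r ∈ ℝ`. -/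
def ofReal (T : IsNumerable 𝔪 (MulAction.orbit G A₀)) (r : ℝ) : CentralExt T :=
  ⟨1, (scalar T (baseLattice G A₀) r).castRight (one_smul G _).symm⟩

noncomputable instance : One (CentralExt T) := ⟨ofReal T 0⟩

noncomputable instance : Inv (CentralExt T) where
  inv p := ⟨p.elt⁻¹, (exists_inverse p.num).choose.move p.elt⁻¹ (inv_smul_smul p.elt _) rfl⟩

theorem mul_elt (p q : CentralExt T) : (p * q).elt = p.elt * q.elt := rfl

theorem mul_num (p q : CentralExt T) : (p * q).num =
    comp p.num (q.num.move p.elt rfl (smul_smul p.elt q.elt _)) := rfl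

theorem ofReal_mul_num (r : ℝ) (p : CentralExt T) : (ofReal T r * p).num =
    (comp (scalar T (baseLattice G A₀) r) p.num).castRight (by rw [mul_elt]; simp [ofReal]) := by
  have key : ∀ (B B' : MulAction.orbit G A₀) (e : baseLattice G A₀ = B)
      (h : (1 : G) • baseLattice G A₀ = B) (h' : (1 : G) • p.elt • baseLattice G A₀ = B')
      (e' : p.elt • baseLattice G A₀ = B'),
      comp ((scalar T (baseLattice G A₀) r).castRight e) (p.num.move (1 : G) h h') =
        (comp (scalar T (baseLattice G A₀) r) p.num).castRight e' := by
    rintro B B' rfl h h' rfl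
    rw [move_one h h' rfl rfl]
    rfl
  exact key _ _ _ _ _ _

noncomputable instance : Group (CentralExt T) :=
  Group.ofLeftAxioms
    (fun p q r => by
      refine ext' (mul_assoc p.elt q.elt r.elt) ?_
      rw [mul_num, mul_num, mul_num, mul_num, comp_assoc, ← comp_castRight, ← comp_castRight,
        castRight_move, move_comp p.elt rfl (smul_smul p.elt q.elt _)]
      exact congrArg (comp p.num) (congrArg (comp _)
        (move_move q.elt p.elt rfl (smul_smul q.elt r.elt _) (smul_smul p.elt q.elt _)
          (smul_smul p.elt (q.elt * r.elt) _) rfl _ r.num).symm))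
    (fun p => by
      refine ext' (one_mul p.elt) ?_
      change (ofReal T 0 * p).num.castRight _ = _
      rw [ofReal_mul_num, scalar_zero_comp]
      generalize_proofs h1 h2
      revert h1 h2
      generalize (ofReal T 0 * p).elt • baseLattice G A₀ = B
      rintro rfl h
      rfl)
    (fun p => by
      refine ext' (inv_mul_cancel p.elt) ?_
      have := (exists_inverse p.num).choose_spec
      change (comp ((exists_inverse p.num).choose.move p.elt⁻¹ (inv_smul_smul p.elt _) rfl)
        (p.num.move p.elt⁻¹ rfl (smul_smul p.elt⁻¹ p.elt _))).castRight _ = _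
      rw [← move_comp, this, move_scalar _ (inv_smul_smul p.elt _),
        castRight_castRight]
      rfl)

theorem ofReal_mul (r s : ℝ) : ofReal T (r + s) = ofReal T r * ofReal T s := by
  refine ext' (one_mul 1).symm ?_
  rw [ofReal_mul_num]
  refine Eq.trans ?_ (congrArg (castRight _)
    (comp_castRight (one_smul G _).symm (scalar T _ r) (scalar T _ s)).symm)
  rw [scalar_comp_scalar]
  rfl

/-- The extension `0 → ℝ → CentralExt T → G → 1`, with the additive group `ℝ` written
multiplicatively. It is central by `extension_central`. -/
noncomputable def extension (T : IsNumerable 𝔪 (MulAction.orbit G A₀)) :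
    GroupExtension (Multiplicative ℝ) (CentralExt T) G where
  inl := MonoidHom.mk' (fun r => ofReal T r.toAdd) (fun r s => ofReal_mul r.toAdd s.toAdd)
  rightHom := MonoidHom.mk' (fun p => p.elt) mul_elt
  inl_injective r s h := by
    have h' : (scalar T (baseLattice G A₀) r.toAdd).castRight (one_smul G _).symm =
      (scalar T (baseLattice G A₀) s.toAdd).castRight (one_smul G _).symm :=
      eq_of_heq (CentralExt.mk.inj h).2
    generalize_proofs e at h'
    revert h' e
    generalize (1 : G) • baseLattice G A₀ = B
    rintro rfl h'
    exact Multiplicative.toAdd.injective (scalar_injective h')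
  range_inl_eq_ker_rightHom := by
    ext p
    constructor
    · rintro ⟨r, rfl⟩
      rfl
    · intro h
      obtain ⟨f, α⟩ := p
      obtain rfl : f = 1 := h
      obtain ⟨r, hr⟩ := exists_scalar (α.castRight (one_smul G _))
      refine ⟨Multiplicative.ofAdd r, ext' rfl ?_⟩
      change (scalar T _ r).castRight _ = α
      rw [← hr]
      exact (castRight_castRight (one_smul G (baseLattice G A₀)) _ α).trans (castRight_rfl α)
  rightHom_surjective f := by
    obtain ⟨α⟩ := RelDim.nonempty T (baseLattice G A₀) (f • baseLattice G A₀)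
    exact ⟨⟨f, α⟩, rfl⟩

theorem extension_central (r : Multiplicative ℝ) (p : CentralExt T) :
    (extension T).inl r * p = p * (extension T).inl r := by
  refine ext' ((one_mul p.elt).trans (mul_one p.elt).symm) ?_
  change (ofReal T _ * p).num.castRight _ =
    comp p.num (((scalar T _ _).castRight _).move p.elt rfl (smul_smul p.elt 1 _))
  rw [ofReal_mul_num, move_castRight, move_scalar _ rfl, comp_castRight, comp_scalar]
  exact castRight_castRight _ _ _

end CentralExt
end CentralExtension

section Commutator

open scoped commutatorElement

variable {N E G : Type*} [Group N] [Group E] [CommGroup G] (S : GroupExtension N E G)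

theorem exists_inl_eq_commutator (p q : E) : ∃ c : N, S.inl c = ⁅p, q⁆ := by
  have : ⁅p, q⁆ ∈ S.inl.range := by
    rw [S.range_inl_eq_ker_rightHom, MonoidHom.mem_ker, map_commutatorElement]
    exact commutatorElement_eq_one_iff_mul_comm.2 (mul_comm _ _)
  exact this

/-- The commutator `⁅f', g'⁆`, regarded as an element of the kernel `N`, of lifts `f'`, `g'` of two
elements of the commutative group `G`. For central extensions it does not depend on the lifts, by
`inl_commutatorSymbol`. -/
noncomputable def commutatorSymbol (f g : G) : N :=
  (exists_inl_eq_commutator S (S.rightHom_surjective f).choose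
    (S.rightHom_surjective g).choose).choose

theorem inl_commutatorSymbol (hS : ∀ (c : N) (p : E), S.inl c * p = p * S.inl c) (p q : E) :
    S.inl (commutatorSymbol S (S.rightHom p) (S.rightHom q)) = ⁅p, q⁆ := by
  have hc : ∀ p p' : E, S.rightHom p' = S.rightHom p → ∃ c : N, p' = S.inl c * p := by
    intro p p' h
    have : p' * p⁻¹ ∈ S.inl.range := by
      rw [S.range_inl_eq_ker_rightHom, MonoidHom.mem_ker, map_mul, map_inv, h, mul_inv_cancel]
    obtain ⟨c, hc⟩ := this
    exact ⟨c, by rw [hc, inv_mul_cancel_right]⟩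
  rw [commutatorSymbol, (exists_inl_eq_commutator S _ _).choose_spec]
  obtain ⟨c, h⟩ := hc p _ (S.rightHom_surjective (S.rightHom p)).choose_spec
  obtain ⟨d, h'⟩ := hc q _ (S.rightHom_surjective (S.rightHom q)).choose_spec
  rw [h, h', commutatorElement_def, commutatorElement_def]
  have c1 : ∀ x, S.inl c * x = x * S.inl c := hS c
  have d1 : ∀ x, S.inl d * x = x * S.inl d := hS d
  generalize S.inl c = a at c1 ⊢
  generalize S.inl d = b at d1 ⊢
  have e1 : a * p * (b * q) = a * b * (p * q) := by
    rw [mul_assoc a, ← mul_assoc p, ← d1 p]; group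
  have e2 : b * q * (a * p) = a * b * (q * p) := by
    rw [mul_assoc b, ← mul_assoc q, ← c1 q, mul_assoc a, ← mul_assoc b, ← c1 b]
  have e3 : a * b * (p * q * (q * p)⁻¹) = p * q * (q * p)⁻¹ * (a * b) := by
    rw [mul_assoc a, d1, ← mul_assoc, c1, mul_assoc _ a]
  calc a * p * (b * q) * (a * p)⁻¹ * (b * q)⁻¹
      = a * p * (b * q) * (b * q * (a * p))⁻¹ := by group
    _ = a * b * (p * q * (q * p)⁻¹) * (a * b)⁻¹ := by rw [e1, e2]; group
    _ = p * q * p⁻¹ * q⁻¹ := by rw [e3]; group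

/-- The commutator symbol on `G` of the central extension attached to `A₀`. -/
noncomputable def CentralExt.symbol {R V G : Type*} [CommRing R] [AddCommGroup V] [Module R V]
    {𝔪 : Ideal R} [CommGroup G] [DistribMulAction G V] [SMulCommClass G R V] {A₀ : Submodule R V}
    (T : IsNumerable 𝔪 (MulAction.orbit G A₀)) (f g : G) : Multiplicative ℝ :=
  commutatorSymbol (CentralExt.extension T) f g

theorem CentralExt.inl_symbol {R V G : Type*} [CommRing R] [AddCommGroup V] [Module R V]
    {𝔪 : Ideal R} [CommGroup G] [DistribMulAction G V] [SMulCommClass G R V] {A₀ : Submodule R V}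
    (T : IsNumerable 𝔪 (MulAction.orbit G A₀)) (p q : CentralExt T) :
    (CentralExt.extension T).inl (CentralExt.symbol T p.elt q.elt) = ⁅p, q⁆ :=
  inl_commutatorSymbol _ CentralExt.extension_central p q

end Commutator

section LocalRings

open scoped TensorProduct

variable (R : Type*) [CommRing R] (I : Ideal R)

/-- For a prime `p` of `R` minimal over `I` (a formal branch at `x` of the curve with ideal `I`), the
completion of the local ring `R_p`: the ring of integers of a two-dimensional local field. -/
abbrev BranchRing (p : I.minimalPrimes) : Type _ :=
  haveI : p.1.IsPrime := p.2.1.1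
  AdicCompletion (IsLocalRing.maximalIdeal (Localization.AtPrime p.1)) (Localization.AtPrime p.1)

/-- The ring `𝒪_{K_{C,x}}`, for `R` the completed local ring of `X` at `x` and `I ⊆ R` the ideal of
`C`: the product over the formal branches of `C` at `x`. -/
abbrev CurveRing : Type _ := ∀ p : I.minimalPrimes, BranchRing R I p

/-- The ring `K_{C,x} = Frac(R) ⊗_R 𝒪_{K_{C,x}}`, the direct sum of the two-dimensional local fields
attached to the formal branches of `C` at `x` (a local equation of `C` becomes invertible in it,
and it is a non-zero element of the maximal ideal of each factor of `𝒪_{K_{C,x}}`). -/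
def CurveLocalRing : Type _ := FractionRing R ⊗[R] CurveRing R I

noncomputable instance : CommRing (CurveLocalRing R I) :=
  inferInstanceAs (CommRing (FractionRing R ⊗[R] CurveRing R I))

noncomputable instance : Algebra (FractionRing R) (CurveLocalRing R I) :=
  inferInstanceAs (Algebra (FractionRing R) (FractionRing R ⊗[R] CurveRing R I))

noncomputable instance : Algebra R (CurveLocalRing R I) :=
  inferInstanceAs (Algebra R (FractionRing R ⊗[R] CurveRing R I))

instance : IsScalarTower R (FractionRing R) (CurveLocalRing R I) :=
  inferInstanceAs (IsScalarTower R (FractionRing R) (FractionRing R ⊗[R] CurveRing R I))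

/-- The natural map from `𝒪_{K_{C,x}}` to `K_{C,x}`. -/
noncomputable def ofCurveRing : CurveRing R I →ₐ[R] CurveLocalRing R I :=
  Algebra.TensorProduct.includeRight (R := R) (A := FractionRing R) (B := CurveRing R I)

/-- The elements of `Frac(R)` with poles only along `C`, that is `⋃ₙ (R : Iⁿ)`. If `R` is complete
and `t` is a local equation of `C`, this is `B_x = lim_n lim_m (tⁿ) / (tᵐ) = R[1/t]`, the ring of
Laurent series in `t` along `C`. -/
def poles : Submodule R (FractionRing R) where
  carrier := {q | ∃ n : ℕ, ∀ a ∈ I ^ n, ∃ r : R, a • q = algebraMap R (FractionRing R) r}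
  zero_mem' := ⟨0, fun a _ => ⟨0, by simp⟩⟩
  add_mem' := by
    rintro q q' ⟨n, hn⟩ ⟨n', hn'⟩
    refine ⟨n + n', fun a ha => ?_⟩
    obtain ⟨r, hr⟩ := hn a (Ideal.pow_le_pow_right (Nat.le_add_right n n') ha)
    obtain ⟨r', hr'⟩ := hn' a (Ideal.pow_le_pow_right (Nat.le_add_left n' n) ha)
    exact ⟨r + r', by rw [smul_add, hr, hr', map_add]⟩
  smul_mem' := by
    rintro c q ⟨n, hn⟩
    refine ⟨n, fun a ha => ?_⟩
    obtain ⟨r, hr⟩ := hn a ha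
    exact ⟨c * r, by rw [smul_comm, hr, map_mul, Algebra.smul_def]⟩

/-- The subspace `B_x` of `K_{C,x}`. -/
noncomputable def pointLattice : Submodule R (CurveLocalRing R I) :=
  (poles R I).map (IsScalarTower.toAlgHom R (FractionRing R) (CurveLocalRing R I)).toLinearMap

/-- The subspace `𝒪_{K_{C,x}}` of `K_{C,x}`. -/
noncomputable def curveLattice : Submodule R (CurveLocalRing R I) :=
  LinearMap.range (ofCurveRing R I).toLinearMap

variable {R I} {𝔪 : Ideal R}

/-- The symbol `[f₁, f₂]_{x,C}`, from the central extension of `Frac(R)^*` attached to `B_x`. -/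
noncomputable def pointSymbol
    (T : IsNumerable 𝔪 (translates (FractionRing R)ˣ (pointLattice R I)))
    (f₁ f₂ : (FractionRing R)ˣ) : Multiplicative ℝ :=
  CentralExt.symbol T f₁ f₂

/-- The symbol `[f₁, f₂]_{C,x}`, from the central extension of `Frac(R)^*` attached to
`𝒪_{K_{C,x}}`. -/
noncomputable def curveSymbol
    (T : IsNumerable 𝔪 (translates (FractionRing R)ˣ (curveLattice R I)))
    (f₁ f₂ : (FractionRing R)ˣ) : Multiplicative ℝ :=
  CentralExt.symbol T f₁ f₂

end LocalRings

section Geometry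

/-- A regular arithmetic surface `π : X → Spec 𝒪_F` over a number field `F`. -/
structure IsRegularArithmeticSurface (F : Type u) [Field F] [NumberField F] {X : Scheme.{u}}
    (π : X ⟶ Spec (CommRingCat.of (NumberField.RingOfIntegers F))) : Prop where
  integral : IsIntegral X
  proper : IsProper π
  flat : Flat π
  dim : topologicalKrullDim X = 2
  regular : ∀ x : X, IsRegularLocalRing (X.presheaf.stalk x)

variable {X : Scheme.{u}}

/-- The completed local ring of `X` at `x`. -/
abbrev CompletedStalk (x : X) : Type u :=
  AdicCompletion (IsLocalRing.maximalIdeal (X.presheaf.stalk x)) (X.presheaf.stalk x)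

/-- The maximal ideal of the completed local ring of `X` at `x`. -/
noncomputable def completedMaximalIdeal (x : X) : Ideal (CompletedStalk x) :=
  (IsLocalRing.maximalIdeal (X.presheaf.stalk x)).map
    (algebraMap (X.presheaf.stalk x) (CompletedStalk x))

theorem genericPoint_specializes (C : TopologicalSpace.IrreducibleCloseds X) {x : X}
    (hx : x ∈ C) : C.isIrreducible.genericPoint ⤳ x := by
  rw [specializes_iff_mem_closure, C.isIrreducible.genericPoint_closure_eq, C.isClosed.closure_eq]
  exact hx

/-- The ideal in the local ring at `x` of the germs that vanish on `C`, that is, at the generic point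
of `C`. -/
noncomputable def curveIdeal (C : TopologicalSpace.IrreducibleCloseds X) {x : X} (hx : x ∈ C) :
    Ideal (X.presheaf.stalk x) :=
  (IsLocalRing.maximalIdeal (X.presheaf.stalk C.isIrreducible.genericPoint)).comap
    (X.presheaf.stalkSpecializes (genericPoint_specializes C hx)).hom

/-- The ideal of `C` in the completed local ring at `x`. -/
noncomputable def completedCurveIdeal (C : TopologicalSpace.IrreducibleCloseds X) {x : X}
    (hx : x ∈ C) : Ideal (CompletedStalk x) :=
  (curveIdeal C hx).map (algebraMap (X.presheaf.stalk x) (CompletedStalk x))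

end Geometry

end ArithSurface

open ArithSurface

/-!
Let `R` be the completed local ring at `x`, let `t` be a local equation of `C`, and write `B` for
`B_x = R[1/t]` and `𝒪` for `𝒪_{K_{C,x}}`. The symbols attached to `B` and `𝒪` are inverse to each
other because the two subspaces of `K_{C,x}` are complementary over `R`:

* `B ∩ 𝒪 = R` (`IsLocalEquation.pointLattice_inf_curveLattice`), because the ideals `(tⁿ)` of the
  regular ring `R` have no embedded component at the closed point;
* every non-zero-divisor of `R` is a product `g u` of a unit `g` of `𝒪` and a unit `u` of `B`
  (`IsLocalEquation.exists_eq_mul`).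

Commutators in a central extension are bimultiplicative and antisymmetric, so that it suffices to
treat elements of the two kinds. If `f` maps `A₀` into itself, a numeration of `A₀ / f A₀` provides
a lift of `f`, and the commutator of two such lifts compares the numerations of `A₀ / f₁ f₂ A₀` that
come from the two filtrations (`CentralExt.symbol_eq`). The numerations are normalized at the
lattices `R + f A₀`. Then both symbols of two units of `B` are trivial, as are those of two units of
`𝒪`, and for a unit `u` of `B` and a unit `g` of `𝒪` the symbols are the logarithms, with opposite
signs, of the same index `[R : u R + g R]` (`CentralExt.symbol_eq_neg_log`,
`symbol_mul_symbol_eq_one`).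

That the quotients `h A₀ / h' A₀` carry numerations, that is, that `A₀ / (R + f A₀)` is `𝔪`-power
torsion, rests on the fact that an ideal containing a power of `t` and an element that vanishes on
no branch of `C` is primary to `𝔪`; for `𝒪` this is combined with simultaneous approximation at the
branches (`exists_mul_eq_algebraMap_add_curveRing`). Finiteness of the indices comes from the
finiteness of the residue field.

All of this uses little about `R`: it is Noetherian, its maximal ideal has two generators, and `t`
starts a regular sequence of length two (`IsLocalEquation`). In such a ring ideals of positive depth
are principal (`exists_eq_span_of_regular`); this yields the factorization `g u`, and applied to
`𝒪_{X,x}` it yields the local equation `t`. Local equations pass to the completion by flatness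
(`IsLocalEquation.algebraMap_of_flat`), and the completion is Noetherian as a quotient of a power
series ring (`AdicCompletion.isNoetherianRing`).
-/

/-! ### Two-dimensional local rings -/

namespace ArithSurface

open IsLocalRing

variable {R : Type*} [CommRing R] [IsNoetherianRing R] [IsLocalRing R]

theorem isPrincipalIdealRing_of_maximalIdeal_eq_span {y : R} (h : maximalIdeal R = Ideal.span {y}) :
    IsPrincipalIdealRing R := by
  refine IsPrincipalIdealRing.of_prime fun P hP => ?_
  by_cases hy : y ∈ P
  · have : P = Ideal.span {y} := le_antisymm (h ▸ le_maximalIdeal hP.ne_top)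
      ((Ideal.span_singleton_le_iff_mem P).2 hy)
    exact ⟨y, this⟩
  · have : P = ⊥ := by
      refine le_bot_iff.1 (Submodule.le_of_le_smul_of_le_jacobson_bot (I := maximalIdeal R)
        (IsNoetherian.noetherian P) (maximalIdeal_le_jacobson _) ?_)
      intro a ha
      obtain ⟨b, rfl⟩ := Ideal.mem_span_singleton.1 (h ▸ le_maximalIdeal hP.ne_top ha)
      exact Submodule.mem_sup_right (Submodule.smul_mem_smul (h ▸ Ideal.mem_span_singleton_self y)
        ((hP.mem_or_mem ha).resolve_left hy))
    rw [this]
    exact bot_isPrincipal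

/-- The ring `R / x` is a principal ideal ring because its maximal ideal is; if `x` is regular
modulo `J`, a generator of the image of `J` in `R / x` lifts to a generator of `J`. -/
theorem exists_eq_span_of_regular_generator {x y : R} (h : maximalIdeal R = Ideal.span {x, y})
    {J : Ideal R} (hx : ∀ a, x * a ∈ J → a ∈ J) : ∃ g, J = Ideal.span {g} := by
  have hxm : x ∈ maximalIdeal R := h ▸ Ideal.subset_span (Set.mem_insert _ _)
  have : Nontrivial (R ⧸ Ideal.span {x}) := Ideal.Quotient.nontrivial_iff.2 fun e =>
    (maximalIdeal.isMaximal R).ne_top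
      (top_le_iff.1 (e ▸ (Ideal.span_singleton_le_iff_mem _).2 hxm))
  let π := Ideal.Quotient.mk (Ideal.span {x})
  have hπ : Function.Surjective π := Ideal.Quotient.mk_surjective
  have : IsLocalRing (R ⧸ Ideal.span {x}) := IsLocalRing.of_surjective' π hπ
  have : IsLocalHom π := IsLocalHom.of_surjective π hπ
  have hy : maximalIdeal (R ⧸ Ideal.span {x}) = Ideal.span {π y} := by
    rw [← IsLocalRing.map_maximalIdeal_of_surjective π hπ, h, Ideal.map_span, Set.image_pair,
      Ideal.Quotient.eq_zero_iff_mem.2 (Ideal.mem_span_singleton_self x), Ideal.span_insert_zero]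
  have := isPrincipalIdealRing_of_maximalIdeal_eq_span hy
  obtain ⟨g', hg'⟩ := IsPrincipalIdealRing.principal (J.map π)
  have hmem : g' ∈ J.map π := hg' ▸ Submodule.mem_span_singleton_self g'
  obtain ⟨g, hg, rfl⟩ := (Ideal.mem_map_iff_of_surjective π hπ).1 hmem
  refine ⟨g, le_antisymm ?_ ((Ideal.span_singleton_le_iff_mem J).2 hg)⟩
  refine Submodule.le_of_le_smul_of_le_jacobson_bot (I := maximalIdeal R)
    (IsNoetherian.noetherian J) (maximalIdeal_le_jacobson _) ?_
  intro a ha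
  have h1 : π a ∈ Ideal.span {π g} := by
    have := Ideal.mem_map_of_mem π ha
    rwa [hg'] at this
  obtain ⟨c, hc⟩ := Ideal.mem_span_singleton'.1 h1
  obtain ⟨c, rfl⟩ := hπ c
  rw [← map_mul, eq_comm, Ideal.Quotient.mk_eq_mk_iff_sub_mem] at hc
  obtain ⟨b, hb⟩ := Ideal.mem_span_singleton.1 hc
  have hbJ : b ∈ J := hx b (hb ▸ J.sub_mem ha (J.mul_mem_left c hg))
  rw [← sub_add_cancel a (c * g), hb, add_comm]
  exact Submodule.add_mem_sup (Ideal.mul_mem_left _ _ (Ideal.mem_span_singleton_self g))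
    (Submodule.smul_mem_smul hxm hbJ)

/-- In a Noetherian local ring whose maximal ideal has two generators, an ideal of positive depth
is principal: one of the elements `x + y ^ k` avoids the finitely many associated primes. -/
theorem exists_eq_span_of_regular {x y : R} (h : maximalIdeal R = Ideal.span {x, y})
    {J : Ideal R} {t : R} (htm : t ∈ maximalIdeal R) (ht : ∀ a, t * a ∈ J → a ∈ J) :
    ∃ g, J = Ideal.span {g} := by
  have hzero : ∀ r : R, (∀ a, r * a ∈ J → a ∈ J) ∨ ∃ p ∈ associatedPrimes R (R ⧸ J), r ∈ p := by
    intro r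
    by_contra! hr
    obtain ⟨⟨a, ha, ha'⟩, hr⟩ := hr
    have : r ∈ {r : R | ∃ x : R ⧸ J, x ≠ 0 ∧ r • x = 0} :=
      ⟨Ideal.Quotient.mk J a, fun e => ha' (Ideal.Quotient.eq_zero_iff_mem.1 e), by
        rw [Algebra.smul_def, Ideal.Quotient.algebraMap_eq, ← map_mul]
        exact Ideal.Quotient.eq_zero_iff_mem.2 ha⟩
    rw [← biUnion_associatedPrimes_eq_zero_divisors] at this
    obtain ⟨p, hp, hrp⟩ := Set.mem_iUnion₂.1 this
    exact hr p hp hrp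
  have htp : ∀ p ∈ associatedPrimes R (R ⧸ J), t ∉ p := by
    intro p hp htp
    have : t ∈ ⋃ p ∈ associatedPrimes R (R ⧸ J), (p : Set R) := Set.mem_iUnion₂.2 ⟨p, hp, htp⟩
    rw [biUnion_associatedPrimes_eq_zero_divisors] at this
    obtain ⟨a, ha, ha'⟩ := this
    obtain ⟨a, rfl⟩ := Ideal.Quotient.mk_surjective a
    rw [Algebra.smul_def, Ideal.Quotient.algebraMap_eq, ← map_mul,
      Ideal.Quotient.eq_zero_iff_mem] at ha'
    exact ha (Ideal.Quotient.eq_zero_iff_mem.2 (ht a ha'))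
  have hk : ∃ k : ℕ, ∀ a, (x + y ^ (k + 1)) * a ∈ J → a ∈ J := by
    by_contra! hk
    have hk' : ∀ k : ℕ, ∃ p ∈ associatedPrimes R (R ⧸ J), x + y ^ (k + 1) ∈ p := by
      intro k
      refine (hzero _).resolve_left fun hk'' => ?_
      obtain ⟨a, ha, ha'⟩ := hk k
      exact ha' (hk'' a ha)
    choose p hp hxp using hk'
    have hfin := (associatedPrimes.finite R (R ⧸ J)).to_subtype
    obtain ⟨k, l, hkl, e⟩ :=
      Finite.exists_ne_map_eq_of_infinite fun k => (⟨p k, hp k⟩ : associatedPrimes R (R ⧸ J))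
    wlog hlt : k < l generalizing k l
    · exact this l k hkl.symm e.symm (lt_of_le_of_ne (not_lt.1 hlt) hkl.symm)
    have hP : (p k).IsPrime := (hp k).isPrime
    have e' : p k = p l := congrArg Subtype.val e
    have hyp : y ∈ p k := by
      have h1 : y ^ (k + 1) * (1 - y ^ (l - k)) ∈ p k := by
        have h2 := (p k).sub_mem (hxp k) (e' ▸ hxp l)
        rw [add_sub_add_left_eq_sub] at h2
        rwa [mul_sub, mul_one, ← pow_add, show k + 1 + (l - k) = l + 1 by omega]
      have hym : y ∈ maximalIdeal R := h ▸ Ideal.subset_span (Set.mem_insert_of_mem _ rfl)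
      refine hP.mem_of_pow_mem _ ((hP.mem_or_mem h1).resolve_right fun h2 => ?_)
      have hu : IsUnit (1 - y ^ (l - k)) := by
        by_contra hu
        have := (maximalIdeal R).add_mem ((mem_maximalIdeal _).2 hu)
          (Ideal.pow_mem_of_mem _ hym (l - k) (by omega))
        rw [sub_add_cancel] at this
        exact (mem_maximalIdeal _).1 this isUnit_one
      exact hP.ne_top (Ideal.eq_top_of_isUnit_mem _ h2 hu)
    have hx : x ∈ p k := by
      have := (p k).sub_mem (hxp k) ((p k).pow_mem_of_mem hyp (k + 1) k.succ_pos)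
      rwa [add_sub_cancel_right] at this
    have : maximalIdeal R ≤ p k := by
      rw [h, Ideal.span_le, Set.insert_subset_iff, Set.singleton_subset_iff]
      exact ⟨hx, hyp⟩
    exact htp _ (hp k) (this htm)
  obtain ⟨k, hk⟩ := hk
  refine exists_eq_span_of_regular_generator (x := x + y ^ (k + 1)) (y := y) ?_ hk
  rw [h]
  refine le_antisymm ?_ ?_ <;> rw [Ideal.span_le, Set.insert_subset_iff, Set.singleton_subset_iff]
  · refine ⟨Ideal.mem_span_pair.2 ⟨1, -y ^ k, by ring⟩, Ideal.subset_span (by simp)⟩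
  · exact ⟨Ideal.mem_span_pair.2 ⟨1, y ^ k, by ring⟩, Ideal.subset_span (by simp)⟩

/-- By Krull's height theorem there is no room for a prime ideal between a prime ideal that contains
a non-zero-divisor and the maximal ideal. -/
theorem eq_of_le_of_ne_maximalIdeal {x y : R} (h : maximalIdeal R = Ideal.span {x, y})
    {p q : Ideal R} [p.IsPrime] [q.IsPrime] {d : R} (hd : d ∈ nonZeroDivisors R) (hdp : d ∈ p)
    (hpq : p ≤ q) (hq : q ≠ maximalIdeal R) : p = q := by
  by_contra hne
  have h1 : 1 ≤ p.height := (Ideal.one_le_height_span_singleton_of_mem_nonZeroDivisors hd).trans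
    (Ideal.height_mono ((Ideal.span_singleton_le_iff_mem p).2 hdp))
  have h2 := Ideal.height_add_one_le_of_lt_of_isPrime (lt_of_le_of_ne hpq hne)
  have h3 := Ideal.height_add_one_le_of_lt_of_isPrime
    (lt_of_le_of_ne (le_maximalIdeal (‹q.IsPrime›.ne_top)) hq)
  have h4 : (maximalIdeal R).height ≤ 2 := by
    refine (Ideal.height_le_card_of_mem_minimalPrimes_span (s := {x, y}) (Set.toFinite _) ?_).trans
      (by exact_mod_cast Set.ncard_insert_le x {y} |>.trans (by simp))
    rw [← h]
    exact ⟨⟨inferInstance, le_rfl⟩, fun _ hb _ => hb.2⟩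
  have : (3 : ℕ∞) ≤ 2 := by
    calc (3 : ℕ∞) = 1 + 1 + 1 := by norm_num
      _ ≤ p.height + 1 + 1 := by gcongr
      _ ≤ q.height + 1 := by gcongr
      _ ≤ 2 := h3.trans h4
  exact absurd this (by decide)

end ArithSurface

/-! ### Local equations of curves -/

namespace ArithSurface

open IsLocalRing

theorem mem_of_mem_minimalPrimes_span {R : Type*} [CommRing R] {t : R} {p : Ideal R}
    (hp : p ∈ (Ideal.span {t}).minimalPrimes) : t ∈ p :=
  (Ideal.span_singleton_le_iff_mem p).1 hp.1.2

/-- The element `t` of the local ring `R` is a local equation of a curve through the closed point: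
the maximal ideal has two generators, and `t` is the first element of a regular sequence of length
two. For Noetherian `R` this makes `R` a regular local ring of dimension two, but neither that `R`
is a domain nor that it has unique factorization is needed. -/
structure IsLocalEquation {R : Type*} [CommRing R] [IsLocalRing R] (t : R) : Prop where
  exists_generators : ∃ x y : R, maximalIdeal R = Ideal.span {x, y}
  mem : t ∈ maximalIdeal R
  mem_nonZeroDivisors : t ∈ nonZeroDivisors R
  exists_regular : ∃ s ∈ maximalIdeal R, ∀ a, s * a ∈ Ideal.span {t} → a ∈ Ideal.span {t}

namespace IsLocalEquation

variable {R : Type*} [CommRing R] [IsLocalRing R] {t : R}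

theorem ne_maximalIdeal (ht : IsLocalEquation t) {p : Ideal R}
    (hp : p ∈ (Ideal.span {t}).minimalPrimes) : p ≠ maximalIdeal R := by
  rintro rfl
  obtain ⟨s, hs, h⟩ := ht.exists_regular
  obtain ⟨a, ha, ha'⟩ := Ideal.exists_mul_mem_of_mem_minimalPrimes hp hs
  exact ha (h a ha')

variable [IsNoetherianRing R]

/-- An ideal that contains a power of `t` and is contained in no branch of the curve is primary to
the maximal ideal. -/
theorem exists_pow_le (ht : IsLocalEquation t) {J : Ideal R} {n : ℕ} (hn : t ^ n ∈ J)
    (hJ : ∀ p ∈ (Ideal.span {t}).minimalPrimes, ¬ J ≤ p) : ∃ k, maximalIdeal R ^ k ≤ J := by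
  obtain ⟨x, y, hxy⟩ := ht.exists_generators
  refine Ideal.exists_pow_le_of_le_radical_of_fg ?_ (IsNoetherian.noetherian _)
  rw [Ideal.radical_eq_sInf, le_sInf_iff]
  rintro q ⟨hq, hqp⟩
  have htq : t ∈ q := hqp.mem_of_pow_mem n (hq hn)
  obtain ⟨p, hp, hpq⟩ := Ideal.exists_minimalPrimes_le ((Ideal.span_singleton_le_iff_mem q).2 htq)
  by_contra hne
  have : p.IsPrime := hp.1.1
  have := eq_of_le_of_ne_maximalIdeal hxy ht.mem_nonZeroDivisors (mem_of_mem_minimalPrimes_span hp)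
    hpq (fun e => hne e.ge)
  exact hJ p hp (this ▸ hq)

/-- Every non-zero-divisor of `R` is the product of an element that vanishes on no branch of the
curve and a divisor of a power of `t`. The first factor generates the ideal `(f : t^∞)`, which is
principal because `t` is regular modulo it. -/
theorem exists_factorization (ht : IsLocalEquation t) {f : R} (hf : f ∈ nonZeroDivisors R) :
    ∃ g u w : R, ∃ n : ℕ, f = g * u ∧ u * w = t ^ n ∧
      ∀ p ∈ (Ideal.span {t}).minimalPrimes, g ∉ p := by
  obtain ⟨x, y, hxy⟩ := ht.exists_generators
  let J : Ideal R :=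
    { carrier := {a | ∃ n : ℕ, f ∣ t ^ n * a}
      zero_mem' := ⟨0, by simp⟩
      add_mem' := by
        rintro a b ⟨n, hn⟩ ⟨k, hk⟩
        refine ⟨n + k, ?_⟩
        rw [show t ^ (n + k) * (a + b) = t ^ k * (t ^ n * a) + t ^ n * (t ^ k * b) by ring]
        exact dvd_add (hn.mul_left _) (hk.mul_left _)
      smul_mem' := by
        rintro c a ⟨n, hn⟩
        refine ⟨n, ?_⟩
        rw [smul_eq_mul, mul_left_comm]
        exact hn.mul_left _ }
  have hJ : ∀ a, t * a ∈ J → a ∈ J := by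
    rintro a ⟨n, hn⟩
    exact ⟨n + 1, by rwa [pow_succ, mul_assoc]⟩
  obtain ⟨g, hg⟩ := exists_eq_span_of_regular hxy ht.mem hJ
  have hfJ : f ∈ J := ⟨0, by simp⟩
  obtain ⟨u, hu⟩ := Ideal.mem_span_singleton.1 (hg ▸ hfJ)
  obtain ⟨n, w, hw⟩ : g ∈ J := hg ▸ Ideal.mem_span_singleton_self g
  have hgr : g ∈ nonZeroDivisors R := by
    rw [hu] at hf
    exact (mul_mem_nonZeroDivisors.1 hf).1
  refine ⟨g, u, w, n, hu, ?_, fun p hp hgp => ?_⟩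
  · rw [hu, mul_comm, mul_assoc] at hw
    exact ((mul_cancel_left_mem_nonZeroDivisors hgr).1 hw).symm
  · -- the prime `p` is minimal over `J = (g)`, so `t ∈ p` is a zero divisor modulo `J`
    have hpp : p.IsPrime := hp.1.1
    have hpJ : p ∈ J.minimalPrimes := by
      refine ⟨⟨hpp, hg ▸ (Ideal.span_singleton_le_iff_mem p).2 hgp⟩, ?_⟩
      rintro q ⟨hq, hJq⟩ hqp
      refine (eq_of_le_of_ne_maximalIdeal hxy hgr (hJq ?_) hqp (ht.ne_maximalIdeal hp)).ge
      exact hg ▸ Ideal.mem_span_singleton_self g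
    obtain ⟨a, ha, ha'⟩ := Ideal.exists_mul_mem_of_mem_minimalPrimes hpJ
      (mem_of_mem_minimalPrimes_span hp)
    exact ha (hJ a ha')

/-- The ideals `(tⁿ)` are unmixed. -/
theorem dvd_of_forall_minimalPrimes (ht : IsLocalEquation t) {n : ℕ} {a : R}
    (h : ∀ p ∈ (Ideal.span {t}).minimalPrimes, ∃ σ ∉ p, t ^ n ∣ σ * a) : t ^ n ∣ a := by
  obtain ⟨s, hs, hst⟩ := ht.exists_regular
  have hsn : ∀ n : ℕ, ∀ b, t ^ n ∣ s * b → t ^ n ∣ b := by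
    intro n
    induction n with
    | zero => intro b _; simp
    | succ n ih =>
      intro b hb
      obtain ⟨c, rfl⟩ := Ideal.mem_span_singleton.1
        (hst b (Ideal.mem_span_singleton.2 ((dvd_pow_self t n.succ_ne_zero).trans hb)))
      rw [pow_succ', mul_left_comm] at hb
      obtain ⟨d, hd⟩ := hb
      rw [mul_assoc, mul_cancel_left_mem_nonZeroDivisors ht.mem_nonZeroDivisors] at hd
      rw [pow_succ']
      exact mul_dvd_mul_left t (ih c ⟨d, hd⟩)
  let J : Ideal R := (Ideal.span {t ^ n}).colon {a}
  have hJ : ∀ b, b ∈ J ↔ t ^ n ∣ b * a := fun b => by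
    rw [Submodule.mem_colon_singleton, smul_eq_mul, Ideal.mem_span_singleton]
  obtain ⟨k, hk⟩ := ht.exists_pow_le (J := J) (n := n) ((hJ _).2 (dvd_mul_right _ _))
    (fun p hp hle => by
      obtain ⟨σ, hσ, hσ'⟩ := h p hp
      exact hσ (hle ((hJ σ).2 hσ')))
  have key : ∀ k : ℕ, t ^ n ∣ s ^ k * a → t ^ n ∣ a := by
    intro k
    induction k with
    | zero => intro h; simpa using h
    | succ k ih => intro h; exact ih (hsn n _ (by rwa [← mul_assoc, ← pow_succ']))
  exact key k ((hJ _).1 (hk (Ideal.pow_mem_pow hs k)))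

end IsLocalEquation
end ArithSurface

/-! ### The formal branches of the curve -/

namespace AdicCompletion

variable {S : Type*} [CommRing S] {I : Ideal S}

/-- An `I`-adically open principal ideal of `S` is the contraction of its extension to the
completion. -/
theorem dvd_of_algebraMap_eq_mul {c a : S} {k : ℕ} (hk : I ^ k ≤ Ideal.span {c})
    {e : AdicCompletion I S} (h : algebraMap S (AdicCompletion I S) a = algebraMap S _ c * e) :
    c ∣ a := by
  obtain ⟨z, hz⟩ := Ideal.Quotient.mk_surjective (evalₐ I k e)
  have h' := congrArg (evalₐ I k) h
  rw [map_mul, AlgHom.commutes, AlgHom.commutes, ← hz, Ideal.Quotient.algebraMap_eq, ← map_mul,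
    Ideal.Quotient.mk_eq_mk_iff_sub_mem] at h'
  have := Ideal.mem_span_singleton.1 (hk h')
  exact (dvd_sub_left (dvd_mul_right c z)).1 this

/-- Modulo an open principal ideal, elements of the completion are represented in `S`. -/
theorem exists_eq_algebraMap_add (hI : I.FG) {c : S} {k : ℕ} (hk : I ^ k ≤ Ideal.span {c})
    (o : AdicCompletion I S) : ∃ z : S, ∃ e : AdicCompletion I S,
      o = algebraMap S _ z + algebraMap S _ c * e := by
  obtain ⟨z, hz⟩ := Submodule.Quotient.mk_surjective _ (eval I S k o)
  have h : o - of I S z ∈ (I ^ k • ⊤ : Submodule S (AdicCompletion I S)) := by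
    rw [pow_smul_top_eq_ker_eval hI, LinearMap.mem_ker, map_sub, sub_eq_zero, ← hz]
    rfl
  have h' := Submodule.smul_mono_left hk h
  rw [Submodule.ideal_span_singleton_smul] at h'
  obtain ⟨e, -, he⟩ := h'
  refine ⟨z, e, ?_⟩
  rw [← Algebra.smul_def, add_comm, ← sub_eq_iff_eq_add]
  exact he.symm

end AdicCompletion

namespace ArithSurface

open IsLocalRing

variable {R : Type*} [CommRing R] {t : R} (p : (Ideal.span {t}).minimalPrimes)

theorem algebraMap_branchRing_apply (a : R) :
    haveI : p.1.IsPrime := p.2.1.1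
    algebraMap R (BranchRing R (Ideal.span {t}) p) a =
      algebraMap (Localization.AtPrime p.1) _ (algebraMap R (Localization.AtPrime p.1) a) := rfl

theorem isUnit_algebraMap_branchRing {a : R} (ha : a ∉ p.1) :
    IsUnit (algebraMap R (BranchRing R (Ideal.span {t}) p) a) := by
  have : p.1.IsPrime := p.2.1.1
  rw [algebraMap_branchRing_apply]
  exact (IsLocalization.map_units (Localization.AtPrime p.1)
    (⟨a, ha⟩ : p.1.primeCompl)).map _

variable [IsNoetherianRing R]

theorem mul_branchRing_injective {a : R} (ha : a ∈ nonZeroDivisors R)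
    {e e' : BranchRing R (Ideal.span {t}) p}
    (h : algebraMap R (BranchRing R (Ideal.span {t}) p) a * e = algebraMap R _ a * e') :
    e = e' := by
  have : p.1.IsPrime := p.2.1.1
  have h1 : IsSMulRegular (Localization.AtPrime p.1) (algebraMap R (Localization.AtPrime p.1) a) :=
    fun x y hxy => by
      have := IsLocalization.map_nonZeroDivisors_le p.1.primeCompl (Localization.AtPrime p.1)
        (Submonoid.mem_map_of_mem _ ha)
      exact (mul_cancel_left_mem_nonZeroDivisors this).1 hxy
  have h2 := IsSMulRegular.of_flat (S := BranchRing R (Ideal.span {t}) p) h1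
  exact h2 h

/-- The maximal ideal of `R_p` has a power inside `(tⁿ)`, because `p` is minimal over `t`. -/
theorem exists_maximalIdeal_pow_le_span (n : ℕ) :
    haveI : p.1.IsPrime := p.2.1.1
    ∃ k, maximalIdeal (Localization.AtPrime p.1) ^ k ≤
      Ideal.span {algebraMap R (Localization.AtPrime p.1) (t ^ n)} := by
  have hp : p.1.IsPrime := p.2.1.1
  refine Ideal.exists_pow_le_of_le_radical_of_fg ?_ (IsNoetherian.noetherian _)
  rw [Ideal.radical_eq_sInf, le_sInf_iff]
  rintro q ⟨hq, hqp⟩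
  have ht : t ∈ q.comap (algebraMap R (Localization.AtPrime p.1)) := by
    have := hq (Ideal.mem_span_singleton_self _)
    rw [map_pow] at this
    exact hqp.mem_of_pow_mem n this
  have hle : q.comap (algebraMap R (Localization.AtPrime p.1)) ≤ p.1 :=
    (Ideal.comap_mono (le_maximalIdeal hqp.ne_top)).trans
      (Localization.AtPrime.under_maximalIdeal (I := p.1)).le
  have := p.2.2 ⟨Ideal.comap_isPrime _ q, (Ideal.span_singleton_le_iff_mem _).2 ht⟩ hle
  rw [← Localization.AtPrime.map_eq_maximalIdeal]
  exact Ideal.map_le_iff_le_comap.2 this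

/-- An element of `R` divisible by `tⁿ` in the branch ring of `p` is divisible by `tⁿ` in `R_p`. -/
theorem exists_dvd_mul_of_branchRing {n : ℕ} {a : R} {e : BranchRing R (Ideal.span {t}) p}
    (h : algebraMap R (BranchRing R (Ideal.span {t}) p) a = algebraMap R _ (t ^ n) * e) :
    ∃ σ ∉ p.1, t ^ n ∣ σ * a := by
  have hp : p.1.IsPrime := p.2.1.1
  obtain ⟨k, hk⟩ := exists_maximalIdeal_pow_le_span p n
  rw [algebraMap_branchRing_apply, algebraMap_branchRing_apply] at h
  obtain ⟨c, hc⟩ := AdicCompletion.dvd_of_algebraMap_eq_mul hk h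
  obtain ⟨⟨b, s⟩, hb⟩ := IsLocalization.surj p.1.primeCompl c
  have : algebraMap R (Localization.AtPrime p.1) (s * a) = algebraMap R _ (t ^ n * b) := by
    rw [map_mul, map_mul, ← hb, hc]; ring
  obtain ⟨σ, hσ⟩ := (IsLocalization.eq_iff_exists p.1.primeCompl _).1 this
  refine ⟨σ * s, (σ * s).2, σ * b, ?_⟩
  rw [mul_assoc, hσ]; ring

/-- Approximation, modulo a power of `t`, of an element of one branch ring by a fraction with
denominator outside `p`. -/
theorem exists_mul_eq_algebraMap_add (n : ℕ) (o : BranchRing R (Ideal.span {t}) p) :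
    ∃ σ ∉ p.1, ∃ a : R, ∃ e : BranchRing R (Ideal.span {t}) p,
      algebraMap R _ σ * o = algebraMap R _ a + algebraMap R _ (t ^ n) * e := by
  have hp : p.1.IsPrime := p.2.1.1
  obtain ⟨k, hk⟩ := exists_maximalIdeal_pow_le_span p n
  obtain ⟨z, e, rfl⟩ := AdicCompletion.exists_eq_algebraMap_add (IsNoetherian.noetherian _) hk o
  obtain ⟨⟨b, s⟩, hb⟩ := IsLocalization.surj p.1.primeCompl z
  refine ⟨s, s.2, b, algebraMap R _ s * e, ?_⟩
  rw [algebraMap_branchRing_apply p b, ← hb, map_mul, ← algebraMap_branchRing_apply,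
    ← algebraMap_branchRing_apply]
  ring

end ArithSurface

/-! ### Approximation along the branches -/

namespace ArithSurface

open IsLocalRing

variable {R : Type*} [CommRing R]

/-- Non-zero-divisors of `R` act injectively on `𝒪_{K_{C,x}}`, by flatness of localization and
completion, so that tensoring with `Frac(R)` loses nothing. -/
theorem ofCurveRing_injective [IsNoetherianRing R] {t : R} :
    Function.Injective (ofCurveRing R (Ideal.span {t})) := by
  intro o o' h
  obtain ⟨c, hc⟩ := (IsLocalizedModule.eq_iff_exists (nonZeroDivisors R)
    (TensorProduct.mk R (FractionRing R) (CurveRing R (Ideal.span {t})) 1)).1 h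
  funext p
  refine mul_branchRing_injective p c.2 ?_
  have := congrFun hc p
  simp only [Submonoid.smul_def, Pi.smul_apply, Algebra.smul_def] at this
  exact this

/-- Simultaneous approximation, modulo a power of `t`, of the components of an element of
`𝒪_{K_{C,x}}` by a fraction whose denominator vanishes on no branch. -/
theorem exists_mul_eq_algebraMap_add_curveRing [IsNoetherianRing R] {t : R} (n : ℕ)
    (o : CurveRing R (Ideal.span {t})) :
    ∃ σ : R, (∀ p ∈ (Ideal.span {t}).minimalPrimes, σ ∉ p) ∧ ∃ a : R,
      ∃ e : CurveRing R (Ideal.span {t}),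
        algebraMap R _ σ * o = algebraMap R _ a + algebraMap R _ (t ^ n) * e := by
  classical
  have hfin := (Ideal.finite_minimalPrimes_of_isNoetherianRing R (Ideal.span {t})).fintype
  have hprime : ∀ p : (Ideal.span {t}).minimalPrimes, p.1.IsPrime := fun p => p.2.1.1
  -- elements of one branch ideal but not of another
  have hsep : ∀ p q : (Ideal.span {t}).minimalPrimes, p ≠ q → ∃ c ∈ q.1, c ∉ p.1 := by
    intro p q hpq
    by_contra! hle
    exact hpq (Subtype.ext (le_antisymm (p.2.2 ⟨hprime q, q.2.1.2⟩ hle) hle))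
  have hsep' : ∀ p q : (Ideal.span {t}).minimalPrimes, ∃ c : R, c ∉ p.1 ∧ (p ≠ q → c ∈ q.1 ∧
      algebraMap R (BranchRing R (Ideal.span {t}) q) c ∈ Ideal.span {algebraMap R _ (t ^ n)}) := by
    intro p q
    by_cases hpq : p = q
    · exact ⟨1, fun h => (hprime p).ne_top ((Ideal.eq_top_iff_one _).2 h), fun h => absurd hpq h⟩
    have := hprime q
    obtain ⟨c, hcq, hcp⟩ := hsep p q hpq
    obtain ⟨k, hk⟩ := exists_maximalIdeal_pow_le_span q n
    refine ⟨c ^ (k + 1), fun h => hcp ((hprime p).mem_of_pow_mem _ h), fun _ =>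
      ⟨Ideal.pow_mem_of_mem _ hcq _ k.succ_pos, ?_⟩⟩
    have h1 : algebraMap R (Localization.AtPrime q.1) c ∈ maximalIdeal _ :=
      (IsLocalization.AtPrime.to_map_mem_maximal_iff _ q.1 c).2 hcq
    obtain ⟨d, hd⟩ := Ideal.mem_span_singleton.1 (hk (Ideal.pow_mem_pow h1 k))
    rw [Ideal.mem_span_singleton, pow_succ, map_mul]
    refine Dvd.dvd.mul_right ⟨algebraMap _ _ d, ?_⟩ _
    rw [algebraMap_branchRing_apply, algebraMap_branchRing_apply, ← map_mul, ← hd, map_pow]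
  choose c hcp hcq using hsep'
  have hε : ∀ p : (Ideal.span {t}).minimalPrimes, ∃ ε : R, ε ∉ p.1 ∧ ∀ q, p ≠ q → ε ∈ q.1 ∧
      algebraMap R (BranchRing R (Ideal.span {t}) q) ε ∈ Ideal.span {algebraMap R _ (t ^ n)} := by
    intro p
    refine ⟨∏ q, c p q, fun h => ?_, fun q hpq => ⟨?_, ?_⟩⟩
    · obtain ⟨q, -, hq⟩ := (hprime p).prod_mem_iff.1 h
      exact hcp p q hq
    · exact Ideal.mem_of_dvd _ (Finset.dvd_prod_of_mem _ (Finset.mem_univ q)) (hcq p q hpq).1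
    · exact Ideal.mem_of_dvd _ (map_dvd _ (Finset.dvd_prod_of_mem _ (Finset.mem_univ q)))
        (hcq p q hpq).2
  choose ε hεp hεq using hε
  choose σ hσ a e he using fun p => exists_mul_eq_algebraMap_add p n (o p)
  refine ⟨∑ q, ε q * σ q, fun p hp h => ?_, ∑ q, ε q * a q, ?_⟩
  · have h1 : ε ⟨p, hp⟩ * σ ⟨p, hp⟩ ∈ p := by
      rw [← Finset.add_sum_erase _ _ (Finset.mem_univ (⟨p, hp⟩ : (Ideal.span {t}).minimalPrimes))]
        at h
      refine (Ideal.add_mem_iff_left _ (Ideal.sum_mem _ fun q hq => ?_)).1 h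
      exact Ideal.mul_mem_right _ _ (hεq q ⟨p, hp⟩ (Finset.ne_of_mem_erase hq)).1
    exact (hp.1.1.mem_or_mem h1).elim (hεp ⟨p, hp⟩) (hσ ⟨p, hp⟩)
  · have key : ∀ p, ∃ e' : BranchRing R (Ideal.span {t}) p,
        algebraMap R _ (∑ q, ε q * σ q) * o p - algebraMap R _ (∑ q, ε q * a q) =
          algebraMap R _ (t ^ n) * e' := by
      intro p
      rw [← dvd_def, ← Ideal.mem_span_singleton, map_sum, map_sum, Finset.sum_mul,
        ← Finset.sum_sub_distrib]
      refine Ideal.sum_mem _ fun q _ => ?_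
      rw [map_mul, map_mul, mul_assoc, ← mul_sub]
      by_cases hqp : q = p
      · subst hqp
        rw [he, add_sub_cancel_left]
        exact Ideal.mul_mem_left _ _ (Ideal.mul_mem_right _ _ (Ideal.mem_span_singleton_self _))
      · exact Ideal.mul_mem_right _ _ (hεq q p hqp).2
    choose e' he' using key
    refine ⟨e', funext fun p => ?_⟩
    have := he' p
    rw [sub_eq_iff_eq_add'] at this
    exact this

/-- A non-zero-divisor of `R`, as an element of the group `Frac(R)^*`. -/
noncomputable def fractionUnit : nonZeroDivisors R →* (FractionRing R)ˣ where
  toFun a := (IsLocalization.map_units (FractionRing R) a).unit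
  map_one' := Units.ext (map_one _)
  map_mul' _ _ := Units.ext (map_mul _ _ _)

theorem exists_eq_fractionUnit_mul_inv (f : (FractionRing R)ˣ) :
    ∃ a b : nonZeroDivisors R, f = fractionUnit a * (fractionUnit b)⁻¹ := by
  obtain ⟨⟨a, b⟩, h⟩ := IsLocalization.surj (nonZeroDivisors R) (f : FractionRing R)
  have hu : IsUnit (algebraMap R (FractionRing R) a) :=
    h ▸ f.isUnit.mul (IsLocalization.map_units _ b)
  have ha : a ∈ nonZeroDivisors R := mem_nonZeroDivisors_of_injective
    (IsFractionRing.injective R (FractionRing R)) hu.mem_nonZeroDivisors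
  exact ⟨⟨a, ha⟩, b, eq_mul_inv_of_mul_eq (Units.ext h)⟩

end ArithSurface

/-! ### The two subspaces attached to a point of a curve -/

namespace ArithSurface

open IsLocalRing

variable {R : Type*} [CommRing R]

theorem fractionUnit_smul {V : Type*} [CommRing V] [Algebra R V] [Algebra (FractionRing R) V]
    [IsScalarTower R (FractionRing R) V] (a : nonZeroDivisors R) (v : V) :
    fractionUnit a • v = (a : R) • v :=
  algebraMap_smul (FractionRing R) (a : R) v

theorem mem_fractionUnit_smul {V : Type*} [CommRing V] [Algebra R V] [Algebra (FractionRing R) V]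
    [IsScalarTower R (FractionRing R) V] {a : nonZeroDivisors R} {A : Submodule R V} {v : V} :
    v ∈ fractionUnit a • A ↔ ∃ w ∈ A, (a : R) • w = v := by
  refine (Submodule.mem_smul_pointwise_iff_exists v (fractionUnit a) A).trans ?_
  simp only [fractionUnit_smul]

theorem smul_injective_of_mem_nonZeroDivisors {V : Type*} [CommRing V] [Algebra R V]
    [Algebra (FractionRing R) V] [IsScalarTower R (FractionRing R) V] {a : R}
    (ha : a ∈ nonZeroDivisors R) : Function.Injective fun v : V => a • v := fun v w h => by
  refine MulAction.injective (fractionUnit ⟨a, ha⟩) ?_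
  simpa only [fractionUnit_smul] using h

theorem fractionUnit_smul_le {V : Type*} [CommRing V] [Algebra R V] [Algebra (FractionRing R) V]
    [IsScalarTower R (FractionRing R) V] (a : nonZeroDivisors R) (A : Submodule R V) :
    fractionUnit a • A ≤ A := by
  intro v hv
  obtain ⟨w, hw, rfl⟩ := mem_fractionUnit_smul.1 hv
  exact A.smul_mem _ hw

theorem one_le_curveLattice (I : Ideal R) : 1 ≤ curveLattice R I := by
  intro v hv
  obtain ⟨a, rfl⟩ := Submodule.mem_one.1 hv
  exact ⟨algebraMap R _ a, (ofCurveRing R I).commutes a⟩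

variable {t : R}

theorem mem_pointLattice (ht : t ∈ nonZeroDivisors R) {v : CurveLocalRing R (Ideal.span {t})} :
    v ∈ pointLattice R (Ideal.span {t}) ↔ ∃ n : ℕ, ∃ a : R, t ^ n • v = algebraMap R _ a := by
  constructor
  · rintro ⟨q, ⟨n, hn⟩, rfl⟩
    obtain ⟨a, ha⟩ := hn (t ^ n) (Ideal.pow_mem_pow (Ideal.mem_span_singleton_self t) n)
    refine ⟨n, a, ?_⟩
    rw [← map_smul, ha]
    exact (IsScalarTower.algebraMap_apply R (FractionRing R) _ a).symm
  · rintro ⟨n, a, h⟩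
    let u := fractionUnit ⟨t ^ n, pow_mem ht n⟩
    have hu : (u : FractionRing R) = algebraMap R _ (t ^ n) := rfl
    refine ⟨algebraMap R _ a * (u⁻¹ : (FractionRing R)ˣ), ⟨n, fun b hb => ?_⟩, ?_⟩
    · rw [Ideal.span_singleton_pow, Ideal.mem_span_singleton] at hb
      obtain ⟨c, rfl⟩ := hb
      refine ⟨c * a, ?_⟩
      rw [Algebra.smul_def, map_mul, ← hu, mul_comm (u : FractionRing R), map_mul, mul_assoc,
        mul_left_comm (u : FractionRing R), Units.mul_inv, mul_one]
    · refine smul_injective_of_mem_nonZeroDivisors (pow_mem ht n) ?_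
      change t ^ n • _ = t ^ n • v
      rw [h, ← map_smul, Algebra.smul_def, ← hu, mul_left_comm, Units.mul_inv, mul_one]
      exact (IsScalarTower.algebraMap_apply R (FractionRing R) _ a).symm

theorem one_le_pointLattice (ht : t ∈ nonZeroDivisors R) :
    1 ≤ pointLattice R (Ideal.span {t}) := by
  intro v hv
  obtain ⟨a, rfl⟩ := Submodule.mem_one.1 hv
  exact (mem_pointLattice ht).2 ⟨0, a, by rw [pow_zero, one_smul]⟩

/-- Divisors of powers of `t` are units of `R[1/t]`. -/
theorem fractionUnit_smul_pointLattice (ht : t ∈ nonZeroDivisors R) {u : nonZeroDivisors R} {w : R}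
    {n : ℕ} (h : u * w = t ^ n) : fractionUnit u • pointLattice R (Ideal.span {t}) =
      pointLattice R (Ideal.span {t}) := by
  refine le_antisymm (fractionUnit_smul_le u _) fun v hv => ?_
  obtain ⟨k, a, hk⟩ := (mem_pointLattice ht).1 hv
  refine mem_fractionUnit_smul.2 ⟨(fractionUnit u)⁻¹ • v, (mem_pointLattice ht).2
    ⟨n + k, w * a, ?_⟩, ?_⟩
  · rw [pow_add, ← h, show (u : R) * w * t ^ k = (w * t ^ k) * u by ring, mul_smul,
      ← fractionUnit_smul, smul_inv_smul, mul_smul, hk, map_mul, Algebra.smul_def]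
  · rw [← fractionUnit_smul, smul_inv_smul]

/-- Elements of `R` that vanish on no branch are units of `𝒪_{K_{C,x}}`. -/
theorem fractionUnit_smul_curveLattice {g : nonZeroDivisors R}
    (hg : ∀ p ∈ (Ideal.span {t}).minimalPrimes, (g : R) ∉ p) :
    fractionUnit g • curveLattice R (Ideal.span {t}) = curveLattice R (Ideal.span {t}) := by
  refine le_antisymm (fractionUnit_smul_le g _) ?_
  rintro _ ⟨o, rfl⟩
  choose e he using fun p : (Ideal.span {t}).minimalPrimes =>
    (isUnit_algebraMap_branchRing p (hg p.1 p.2)).exists_right_inv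
  refine mem_fractionUnit_smul.2 ⟨ofCurveRing R _ (fun p => e p * o p), ⟨_, rfl⟩, ?_⟩
  rw [← map_smul]
  refine congrArg _ (funext fun p => ?_)
  rw [Pi.smul_apply, Algebra.smul_def, ← mul_assoc, he, one_mul]

variable [IsNoetherianRing R] [IsLocalRing R]

/-- `B_x ∩ 𝒪_{K_{C,x}} = R`. -/
theorem IsLocalEquation.pointLattice_inf_curveLattice (ht : IsLocalEquation t) :
    pointLattice R (Ideal.span {t}) ⊓ curveLattice R (Ideal.span {t}) ≤ 1 := by
  rintro _ ⟨hB, ⟨o, rfl⟩⟩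
  obtain ⟨n, a, h⟩ := (mem_pointLattice ht.mem_nonZeroDivisors).1 hB
  have h1 : algebraMap R _ a = t ^ n • o := by
    refine ofCurveRing_injective (R := R) (t := t) ?_
    rw [AlgHom.commutes, map_smul]
    exact h.symm
  have h2 : t ^ n ∣ a := ht.dvd_of_forall_minimalPrimes fun p hp =>
    exists_dvd_mul_of_branchRing ⟨p, hp⟩ (e := o ⟨p, hp⟩) (by
      have := congrFun h1 ⟨p, hp⟩
      rwa [Pi.smul_apply, Algebra.smul_def] at this)
  obtain ⟨b, rfl⟩ := h2
  refine Submodule.mem_one.2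
    ⟨b, smul_injective_of_mem_nonZeroDivisors (pow_mem ht.mem_nonZeroDivisors n) ?_⟩
  refine Eq.trans ?_ h.symm
  rw [map_mul, ← Algebra.smul_def]

/-- Every non-zero-divisor of `R` is a unit of `𝒪_{K_{C,x}}` times a unit of `B_x`. -/
theorem IsLocalEquation.exists_eq_mul (ht : IsLocalEquation t) (f : nonZeroDivisors R) :
    ∃ g u : nonZeroDivisors R, f = g * u ∧ (∃ w n, (u : R) * w = t ^ n) ∧
      ∀ p ∈ (Ideal.span {t}).minimalPrimes, (g : R) ∉ p := by
  obtain ⟨g, u, w, n, h, h', hg⟩ := ht.exists_factorization f.2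
  have := mul_mem_nonZeroDivisors.1 (h ▸ f.2)
  exact ⟨⟨g, this.1⟩, ⟨u, this.2⟩, Subtype.ext h, ⟨w, n, h'⟩, hg⟩

/-- The quotients `B_x / (R + f B_x)` are `𝔪`-power torsion: if `f = g u` with `u` a unit of `B_x`,
an element `a / tᵐ` is killed by the ideal `(tᵐ, g)`, which is primary to `𝔪`. -/
theorem IsLocalEquation.exists_smul_mem_pointLattice (ht : IsLocalEquation t)
    (f : nonZeroDivisors R) {v : CurveLocalRing R (Ideal.span {t})}
    (hv : v ∈ pointLattice R (Ideal.span {t})) : ∃ k, ∀ r ∈ maximalIdeal R ^ k,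
      r • v ∈ 1 ⊔ fractionUnit f • pointLattice R (Ideal.span {t}) := by
  obtain ⟨g, u, rfl, ⟨w, n, hu⟩, hg⟩ := ht.exists_eq_mul f
  obtain ⟨m, a, ha⟩ := (mem_pointLattice ht.mem_nonZeroDivisors).1 hv
  obtain ⟨k, hk⟩ := ht.exists_pow_le (J := Ideal.span {t ^ m, (g : R)})
    (Ideal.subset_span (Set.mem_insert _ _))
    (fun p hp hle => hg p hp (hle (Ideal.subset_span (Set.mem_insert_of_mem _ rfl))))
  refine ⟨k, fun r hr => ?_⟩
  obtain ⟨c, d, rfl⟩ := Ideal.mem_span_pair.1 (hk hr)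
  rw [map_mul, mul_smul, fractionUnit_smul_pointLattice ht.mem_nonZeroDivisors hu, add_smul]
  refine Submodule.add_mem_sup ?_ (mem_fractionUnit_smul.2 ⟨d • v, Submodule.smul_mem _ _ hv, ?_⟩)
  · rw [mul_smul, ha]
    exact Submodule.smul_mem _ _ (Submodule.mem_one.2 ⟨a, rfl⟩)
  · rw [smul_smul, mul_comm]

/-- The quotients `𝒪 / (R + f 𝒪)` of `𝒪 = 𝒪_{K_{C,x}}` are `𝔪`-power torsion: `f 𝒪` contains `tⁿ 𝒪`
for some `n`, and an element congruent to `a / σ` modulo `tⁿ 𝒪` is killed by the ideal `(tⁿ, σ)`,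
which is primary to `𝔪`. -/
theorem IsLocalEquation.exists_smul_mem_curveLattice (ht : IsLocalEquation t)
    (f : nonZeroDivisors R) {v : CurveLocalRing R (Ideal.span {t})}
    (hv : v ∈ curveLattice R (Ideal.span {t})) : ∃ k, ∀ r ∈ maximalIdeal R ^ k,
      r • v ∈ 1 ⊔ fractionUnit f • curveLattice R (Ideal.span {t}) := by
  obtain ⟨g, u, rfl, ⟨w, n, hu⟩, hg⟩ := ht.exists_eq_mul f
  rw [mul_comm, map_mul, mul_smul, fractionUnit_smul_curveLattice hg]
  obtain ⟨o, rfl⟩ := hv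
  have htn : ∀ o, t ^ n • ofCurveRing R (Ideal.span {t}) o ∈
      fractionUnit u • curveLattice R (Ideal.span {t}) := fun o =>
    mem_fractionUnit_smul.2 ⟨w • ofCurveRing R _ o, Submodule.smul_mem _ _ ⟨o, rfl⟩, by
      rw [smul_smul, hu]⟩
  obtain ⟨σ, hσ, a, e, h⟩ := exists_mul_eq_algebraMap_add_curveRing n o
  obtain ⟨k, hk⟩ := ht.exists_pow_le (J := Ideal.span {t ^ n, σ})
    (Ideal.subset_span (Set.mem_insert _ _))
    (fun p hp hle => hσ p hp (hle (Ideal.subset_span (Set.mem_insert_of_mem _ rfl))))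
  refine ⟨k, fun r hr => ?_⟩
  obtain ⟨c, d, rfl⟩ := Ideal.mem_span_pair.1 (hk hr)
  have h' : σ • ofCurveRing R (Ideal.span {t}) o =
      algebraMap R _ a + t ^ n • ofCurveRing R (Ideal.span {t}) e := by
    have h1 : σ • o = algebraMap R _ a + t ^ n • e :=
      (Algebra.smul_def σ o).trans (h.trans (congrArg _ (Algebra.smul_def (t ^ n) e).symm))
    rw [← map_smul, h1, map_add, map_smul, AlgHom.commutes]
  rw [add_smul, mul_smul, mul_smul]
  refine Submodule.add_mem _ (Submodule.smul_mem _ _ (Submodule.mem_sup_right (htn o)))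
    (Submodule.smul_mem _ _ ?_)
  refine h' ▸ Submodule.add_mem_sup (Submodule.mem_one.2 ⟨a, rfl⟩) (htn e)

end ArithSurface

/-! ### Existence of numerations -/

namespace ArithSurface

open IsLocalRing

section

variable {R V : Type*} [CommRing R] [IsNoetherianRing R] [AddCommGroup V] [Module R V]
  {𝔪 : Ideal R}

theorem IsLattice.inf {A C C' L : Submodule R V} (hC : C' ≤ C) (hA : C ≤ A)
    (h : IsLattice 𝔪 A C' L) : IsLattice 𝔪 C C' (L ⊓ C) := by
  obtain ⟨M, hM, e⟩ := h.fg
  refine ⟨le_inf h.le_left hC, inf_le_right, ⟨M ⊓ C, ?_, ?_⟩, fun a ha => ?_⟩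
  · have := isNoetherian_of_fg_of_noetherian M hM
    exact isNoetherian_submodule.1 this _ inf_le_left
  · rw [e, sup_inf_assoc_of_le _ hC]
  · obtain ⟨n, hn⟩ := h.torsion a (hA ha)
    exact ⟨n, fun r hr => ⟨hn r hr, C.smul_mem r ha⟩⟩

theorem IsCompactOpen.inf {A C C' : Submodule R V} {U : AddSubgroup V} (hC : C' ≤ C) (hA : C ≤ A)
    (h : IsCompactOpen 𝔪 A C' U) : IsCompactOpen 𝔪 C C' (U ⊓ C.toAddSubgroup) := by
  obtain ⟨L, L', hL, hL', h1, h2⟩ := h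
  exact ⟨_, _, hL.inf hC hA, hL'.inf hC hA, inf_le_inf_right C.toAddSubgroup h1,
    inf_le_inf_right C.toAddSubgroup h2⟩

variable [Finite (R ⧸ 𝔪)]

/-- A finitely generated module whose elements are killed by powers of `𝔪` is a finitely generated
module over some `R / 𝔪ⁿ`, which is finite. -/
theorem IsLattice.relIndex_ne_zero {A C L L' : Submodule R V} (h : IsLattice 𝔪 A C L)
    (h' : IsLattice 𝔪 A C L') (hL : L ≤ L') :
    L.toAddSubgroup.relIndex L'.toAddSubgroup ≠ 0 := by
  obtain ⟨M, hM, e⟩ := h'.fg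
  have hLM : L'.toAddSubgroup = L.toAddSubgroup ⊔ M.toAddSubgroup := by
    rw [← Submodule.sup_toAddSubgroup]
    congr 1
    refine le_antisymm ?_ (sup_le hL (e ▸ le_sup_right))
    rw [e]
    exact sup_le_sup_right h.le_left M
  have hMA : M ≤ A := le_trans (e ▸ le_sup_right) h'.le_right
  have hn : ∃ n, ∀ m ∈ M, ∀ r ∈ 𝔪 ^ n, r • m ∈ L := by
    obtain ⟨s, rfl⟩ := hM
    have : ∃ n, ∀ m ∈ s, ∀ r ∈ 𝔪 ^ n, r • m ∈ L := by
      choose! k hk using h.torsion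
      refine ⟨s.sup k, fun m hm r hr => hk m (hMA (Submodule.subset_span hm)) r ?_⟩
      exact Ideal.pow_le_pow_right (Finset.le_sup hm) hr
    obtain ⟨n, hn⟩ := this
    refine ⟨n, fun m hm r hr => ?_⟩
    have : Submodule.span R (s : Set V) ≤ L.comap (LinearMap.lsmul R V r) :=
      Submodule.span_le.2 fun x hx => hn x hx r hr
    exact this hm
  obtain ⟨n, hn⟩ := hn
  rw [hLM, sup_comm, AddSubgroup.relIndex_sup_right, AddSubgroup.relIndex]
  let Q := M ⧸ L.submoduleOf M
  have hfin : Finite Q := by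
    have : Module.Finite R M := Module.Finite.iff_fg.2 hM
    have htors : Module.IsTorsionBySet R Q (𝔪 ^ n : Ideal R) := by
      intro q r
      obtain ⟨m, rfl⟩ := Submodule.Quotient.mk_surjective _ q
      exact (Submodule.Quotient.mk_eq_zero _).2 (hn m m.2 r r.2)
    let := htors.module
    have : IsScalarTower R (R ⧸ 𝔪 ^ n) Q := htors.isScalarTower
    have : Module.Finite (R ⧸ 𝔪 ^ n) Q := Module.Finite.of_restrictScalars_finite R _ _
    have : Finite (R ⧸ 𝔪 ^ n) := Ideal.finite_quotient_pow (IsNoetherian.noetherian 𝔪) n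
    exact Module.finite_of_finite (R ⧸ 𝔪 ^ n)
  exact AddSubgroup.index_ne_zero_iff_finite.2 hfin

theorem IsCompactOpen.relIndex_ne_zero {A C : Submodule R V} {U U' : AddSubgroup V}
    (h : IsCompactOpen 𝔪 A C U) (h' : IsCompactOpen 𝔪 A C U') (hU : U ≤ U') :
    U.relIndex U' ≠ 0 := by
  obtain ⟨L, -, hL, -, h1, -⟩ := h
  obtain ⟨-, L', -, hL', -, h2⟩ := h'
  have := hL.relIndex_ne_zero hL' (h1.trans (hU.trans h2))
  rw [← AddSubgroup.relIndex_mul_relIndex _ _ _ h1 (hU.trans h2),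
    ← AddSubgroup.relIndex_mul_relIndex _ _ _ hU h2] at this
  exact left_ne_zero_of_mul (right_ne_zero_of_mul this)

end

variable {R V G : Type*} [CommRing R] [AddCommGroup V] [Module R V] [CommGroup G]
  [DistribMulAction G V] [SMulCommClass G R V] {𝔪 : Ideal R} {A₀ E : Submodule R V}
  {φ : nonZeroDivisors R →* G}

theorem smul_le_of_smul_eq (hφ : ∀ a, ∀ v : V, φ a • v = (a : R) • v) (a : nonZeroDivisors R)
    (A : Submodule R V) : φ a • A ≤ A := by
  rintro _ ⟨v, hv, rfl⟩
  exact (congrArg (· ∈ A) (hφ a v)).mpr (A.smul_mem _ hv)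

theorem isLattice_sup_smul (hφ : ∀ a, ∀ v : V, φ a • v = (a : R) • v)
    (hG : ∀ f, ∃ a b, f = φ a * (φ b)⁻¹) (hE : E.FG) (hEA : E ≤ A₀)
    (htors : ∀ a, ∀ v ∈ A₀, ∃ k, ∀ r ∈ 𝔪 ^ k, r • v ∈ E ⊔ φ a • A₀) {f : G} (hf : f • A₀ ≤ A₀) :
    IsLattice 𝔪 A₀ (f • A₀) (E ⊔ f • A₀) := by
  refine ⟨le_sup_right, sup_le hEA hf, ⟨E, hE, sup_comm _ _⟩, fun v hv => ?_⟩
  obtain ⟨a, b, e⟩ := hG f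
  obtain ⟨k, hk⟩ := htors a v hv
  refine ⟨k, fun r hr => (sup_le_sup_left ?_ E : E ⊔ φ a • A₀ ≤ E ⊔ f • A₀) (hk r hr)⟩
  rw [← eq_mul_inv_iff_mul_eq.1 e, mul_smul]
  exact smul_mono_right f (smul_le_of_smul_eq hφ b A₀)

/-- Let `G` be the group of fractions of the non-zero-divisors of `R`, acting on `V`. The
submodules `h A₀` form a two-dimensional system as soon as, for a fixed finitely generated `E`, the
quotients `A₀ / (E + a A₀)` are `𝔪`-power torsion for all non-zero-divisors `a` of `R`. -/
theorem isNumerable_translates [IsNoetherianRing R] [Finite (R ⧸ 𝔪)]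
    (hφ : ∀ a, ∀ v : V, φ a • v = (a : R) • v) (hG : ∀ f, ∃ a b, f = φ a * (φ b)⁻¹) (hE : E.FG)
    (hEA : E ≤ A₀) (htors : ∀ a, ∀ v ∈ A₀, ∃ k, ∀ r ∈ 𝔪 ^ k, r • v ∈ E ⊔ φ a • A₀) :
    IsNumerable 𝔪 (translates G A₀) where
  directed := by
    rintro ⟨_, f, rfl⟩ ⟨_, g, rfl⟩
    obtain ⟨a, b, e⟩ := hG f
    obtain ⟨c, d, e'⟩ := hG g
    refine ⟨⟨φ (a * c) • A₀, φ (a * c), rfl⟩, ?_, ?_⟩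
    · change φ (a * c) • A₀ ≤ f • A₀
      rw [map_mul, ← eq_mul_inv_iff_mul_eq.1 e, mul_assoc, ← map_mul, mul_smul]
      exact smul_mono_right f (smul_le_of_smul_eq hφ _ A₀)
    · change φ (a * c) • A₀ ≤ g • A₀
      rw [mul_comm, map_mul, ← eq_mul_inv_iff_mul_eq.1 e', mul_assoc, ← map_mul, mul_smul]
      exact smul_mono_right g (smul_le_of_smul_eq hφ _ A₀)
  exists_isCompactOpen := by
    rintro ⟨_, f, rfl⟩ ⟨_, g, rfl⟩ (hle : g • A₀ ≤ f • A₀)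
    have hle' : (f⁻¹ * g) • A₀ ≤ A₀ := by
      rw [mul_smul]
      exact (smul_mono_right f⁻¹ hle).trans (inv_smul_smul f A₀).le
    have h := (isLattice_sup_smul hφ hG hE hEA htors hle').smul f
    rw [← mul_smul f (f⁻¹ * g) A₀, mul_inv_cancel_left] at h
    exact ⟨_, _, _, h, h, le_rfl, le_rfl⟩
  relIndex_ne_zero _ _ _ _ _ h h' hU := h.relIndex_ne_zero h' hU
  inter _ _ _ hC hA _ h := h.inf hC hA

end ArithSurface

/-! ### The commutator symbol -/

namespace ArithSurface

section Commutator

open scoped commutatorElement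

variable {N E G : Type*} [Group N] [Group E] [CommGroup G] {S : GroupExtension N E G}

theorem commutatorSymbol_mul_right (hS : ∀ (c : N) (p : E), S.inl c * p = p * S.inl c)
    (f g g' : G) : commutatorSymbol S f (g * g') =
      commutatorSymbol S f g * commutatorSymbol S f g' := by
  obtain ⟨p, rfl⟩ := S.rightHom_surjective f
  obtain ⟨q, rfl⟩ := S.rightHom_surjective g
  obtain ⟨r, rfl⟩ := S.rightHom_surjective g'
  refine S.inl_injective ?_
  have h := hS (commutatorSymbol S (S.rightHom p) (S.rightHom r)) q
  rw [← map_mul, inl_commutatorSymbol S hS, map_mul, inl_commutatorSymbol S hS,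
    inl_commutatorSymbol S hS]
  rw [inl_commutatorSymbol S hS] at h
  calc ⁅p, q * r⁆ = ⁅p, q⁆ * (q * ⁅p, r⁆) * q⁻¹ := by simp only [commutatorElement_def]; group
    _ = ⁅p, q⁆ * ⁅p, r⁆ := by rw [← h]; group

theorem commutatorSymbol_inv (hS : ∀ (c : N) (p : E), S.inl c * p = p * S.inl c) (f g : G) :
    (commutatorSymbol S f g)⁻¹ = commutatorSymbol S g f := by
  obtain ⟨p, rfl⟩ := S.rightHom_surjective f
  obtain ⟨q, rfl⟩ := S.rightHom_surjective g
  refine S.inl_injective ?_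
  rw [map_inv, inl_commutatorSymbol S hS, inl_commutatorSymbol S hS, commutatorElement_inv]

end Commutator

section Numerations

variable {R V : Type*} [CommRing R] [AddCommGroup V] [Module R V] {𝔪 : Ideal R}

/-- The numeration of the zero group `A / A` that takes the value zero. -/
def Num.trivial (𝔪 : Ideal R) (A : Submodule R V) : Num 𝔪 A A where
  val _ _ := 0
  rule U U' hU hU' _ := by
    have h : U = U' := (hU.le_right.trans hU'.left_le).antisymm (hU'.le_right.trans hU.left_le)
    rw [h, AddSubgroup.relIndex_self, Nat.cast_one, Real.log_one, add_zero]

variable {Λ : Set (Submodule R V)} {T : IsNumerable 𝔪 Λ}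

theorem IsNumerable.concat_trivial_left {A C : Λ} (h : C ≤ A)
    (n : Num 𝔪 (A : Submodule R V) C) :
    T.concat h le_rfl (Num.trivial 𝔪 (A : Submodule R V)) n = n := by
  refine Num.ext ?_
  funext U hU
  exact (zero_add _).trans (n.val_congr (inf_eq_left.2 hU.le_right) _ _)

/-- A numeration of `A / C` gives an element of `[A | C]₂`. -/
theorem RelDim.exists_of_num {A C : Λ} (h : C ≤ A) (n : Num 𝔪 (A : Submodule R V) C) :
    ∃ α : RelDim T A C, α.hom C h le_rfl n = Num.trivial 𝔪 (C : Submodule R V) ∧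
      ∀ D (hD : D ≤ C) m, α.hom D (hD.trans h) hD (T.concat hD h n m) = m := by
  choose r hr using T.exists_vadd h n
  obtain ⟨α, hα⟩ := RelDim.exists_of (T := T) (A' := C) C h le_rfl
    (fun m => r m +ᵥ Num.trivial 𝔪 (C : Submodule R V)) (fun s m => by
      have : r (s +ᵥ m) = s + r m := by
        apply T.vadd_inj h (n := n)
        rw [← hr, ← Num.vadd_vadd, ← hr]
      rw [this, Num.vadd_vadd])
  have hn : α.hom C h le_rfl n = Num.trivial 𝔪 (C : Submodule R V) := by
    have : r n = 0 := T.vadd_inj h (n := n) (by rw [← hr, Num.zero_vadd'])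
    rw [hα]
    change r n +ᵥ _ = _
    rw [this, Num.zero_vadd']
  refine ⟨α, hn, fun D hD m => ?_⟩
  rw [α.compat C D hD h le_rfl, hn, T.concat_trivial_left]

/-- If two numerations of `A / X` differ by `s`, so do the elements of `[A | X]₂` that they define.
The equality `X' = X` keeps apart the two ways of writing `f₁ f₂ A₀`. -/
theorem RelDim.castRight_scalar_comp {A X X' : Λ} (e : X' = X) (h : X ≤ A) (h' : X' ≤ A)
    {γ : RelDim T A X} {δ : RelDim T A X'} {n : Num 𝔪 (A : Submodule R V) X}
    {n' : Num 𝔪 (A : Submodule R V) X'}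
    (hγ : γ.hom X h le_rfl n = Num.trivial 𝔪 (X : Submodule R V))
    (hδ : δ.hom X' h' le_rfl n' = Num.trivial 𝔪 (X' : Submodule R V)) {s : ℝ}
    (hs : ∀ U hU hU', n'.val U hU' = s + n.val U hU) :
    (RelDim.comp (RelDim.scalar T A s) δ).castRight e = γ := by
  subst e
  obtain rfl : n' = s +ᵥ n := Num.ext (by funext U hU; exact hs U hU hU)
  refine RelDim.ext_of X' h le_rfl ?_
  funext m
  obtain ⟨r, rfl⟩ := T.exists_vadd h n m
  rw [γ.hom_vadd, hγ, ← hδ, ← δ.hom_vadd, RelDim.castRight_rfl, RelDim.comp_hom _ _ X' h h le_rfl]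
  refine congrArg _ ?_
  change s +ᵥ (r +ᵥ n) = _
  rw [Num.vadd_vadd, Num.vadd_vadd, add_comm]

end Numerations

section Symbol

variable {R V G : Type*} [CommRing R] [AddCommGroup V] [Module R V] {𝔪 : Ideal R} [CommGroup G]
  [DistribMulAction G V] [SMulCommClass G R V] {A₀ : Submodule R V}

/-- The product of the elements of `[A | f A]₂` and `[f A | f D]₂` attached to numerations of
`A / f A` and `A / D` is attached to the concatenated numeration of `A / f D`. -/
theorem RelDim.comp_move_hom {T : IsNumerable 𝔪 (MulAction.orbit G A₀)} (f : G)
    {A C D X : MulAction.orbit G A₀} (hC : f • A = C) (hX : f • D = X) (h : C ≤ A) (h' : D ≤ A)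
    (hX' : X ≤ C) {n : Num 𝔪 (A : Submodule R V) C} {n' : Num 𝔪 (A : Submodule R V) D}
    {α : RelDim T A C} {β : RelDim T A D}
    (hα : ∀ E (hE : E ≤ C) m, α.hom E (hE.trans h) hE (T.concat hE h n m) = m)
    (hβ : β.hom D h' le_rfl n' = Num.trivial 𝔪 (D : Submodule R V)) :
    (RelDim.comp α (β.move f hC hX)).hom X (hX'.trans h) le_rfl
      (T.concat hX' h n (n'.move f (orbit_coe hC) (orbit_coe hX))) =
        Num.trivial 𝔪 (X : Submodule R V) := by
  rw [RelDim.comp_hom _ _ X _ hX' _, hα, RelDim.move_hom f hC hX β D X hX h' le_rfl, hβ]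
  rfl

/-- If `f₁` and `f₂` map `A₀` into itself, numerations of `A₀ / f₁ A₀` and `A₀ / f₂ A₀` provide
lifts of `f₁` and `f₂`. The commutator compares the two numerations of `A₀ / f₁ f₂ A₀` that they
induce through the filtrations `f₁ f₂ A₀ ⊆ f₁ A₀ ⊆ A₀` and `f₁ f₂ A₀ ⊆ f₂ A₀ ⊆ A₀`. -/
theorem CentralExt.symbol_eq (T : IsNumerable 𝔪 (MulAction.orbit G A₀)) {f₁ f₂ : G}
    (h₁ : f₁ • A₀ ≤ A₀) (h₂ : f₂ • A₀ ≤ A₀) (n₁ : Num 𝔪 A₀ (f₁ • A₀)) (n₂ : Num 𝔪 A₀ (f₂ • A₀))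
    {U : AddSubgroup V} (hU : IsCompactOpen 𝔪 A₀ ((f₁ * f₂) • A₀) U)
    (h₁U : IsCompactOpen 𝔪 A₀ (f₁ • A₀) (U ⊔ (f₁ • A₀).toAddSubgroup))
    (h₂U : IsCompactOpen 𝔪 A₀ (f₂ • A₀) (U ⊔ (f₂ • A₀).toAddSubgroup))
    (k₁U : IsCompactOpen 𝔪 A₀ (f₂ • A₀) (f₁⁻¹ • (U ⊓ (f₁ • A₀).toAddSubgroup)))
    (k₂U : IsCompactOpen 𝔪 A₀ (f₁ • A₀) (f₂⁻¹ • (U ⊓ (f₂ • A₀).toAddSubgroup))) :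
    CentralExt.symbol T f₁ f₂ = Multiplicative.ofAdd
      (n₂.val _ h₂U + n₁.val _ k₂U - (n₁.val _ h₁U + n₂.val _ k₁U)) := by
  let B := baseLattice G A₀
  have le₁ : f₁ • B ≤ B := h₁
  have le₂ : f₂ • B ≤ B := h₂
  obtain ⟨α, hα, hα'⟩ := RelDim.exists_of_num (T := T) le₁ n₁
  obtain ⟨β, hβ, hβ'⟩ := RelDim.exists_of_num (T := T) le₂ n₂
  let p : CentralExt T := ⟨f₁, α⟩
  let q : CentralExt T := ⟨f₂, β⟩
  have e₁ : f₁ • f₂ • B = (f₁ * f₂) • B := smul_smul _ _ _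
  have e₂ : f₂ • f₁ • B = (f₂ * f₁) • B := smul_smul _ _ _
  have le₁' : (f₁ * f₂) • B ≤ f₁ • B := e₁ ▸ orbit_smul_le f₁ le₂
  have le₂' : (f₂ * f₁) • B ≤ f₂ • B := e₂ ▸ orbit_smul_le f₂ le₁
  have hγ := RelDim.comp_move_hom (A := B) f₁ rfl e₁ le₁ le₂ le₁' hα' hβ
  have hδ := RelDim.comp_move_hom (A := B) f₂ rfl e₂ le₂ le₁ le₂' hβ' hα
  set n := T.concat le₁' le₁ n₁ (n₂.move f₁ (orbit_coe rfl) (orbit_coe e₁))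
  set n' := T.concat le₂' le₂ n₂ (n₁.move f₂ (orbit_coe rfl) (orbit_coe e₂))
  have e : (f₂ * f₁) • B = (f₁ * f₂) • B := by rw [mul_comm]
  set s := n₂.val _ h₂U + n₁.val _ k₂U - (n₁.val _ h₁U + n₂.val _ k₁U)
  have hs : ∀ W hW hW', n'.val W hW' = s + n.val W hW := by
    have key : ∀ (X : MulAction.orbit G A₀) (e : X = (f₁ * f₂) • B)
        (m : Num 𝔪 (B : Submodule R V) X), (∀ hU', m.val U hU' = s + n.val U hU) →
        ∀ W hW hW', m.val W hW' = s + n.val W hW := by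
      rintro X rfl m hm W hW hW'
      obtain ⟨r, rfl⟩ := T.exists_vadd (le₁'.trans le₁) n m
      have : r + n.val U hU = s + n.val U hU := hm hU
      change r + n.val W hW = s + n.val W hW
      rw [add_right_cancel this]
    refine key _ e n' fun hU' => ?_
    change n₂.val _ _ + n₁.val _ _ = s + (n₁.val _ _ + n₂.val _ _)
    exact (sub_add_cancel _ _).symm
  have hpq : p * q = CentralExt.ofReal T s * (q * p) := by
    refine (CentralExt.ext' (((one_mul (f₂ * f₁)).trans (mul_comm _ _))) ?_).symm
    rw [CentralExt.ofReal_mul_num, RelDim.castRight_castRight]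
    exact RelDim.castRight_scalar_comp e (le₁'.trans le₁) (le₂'.trans le₂) hγ hδ hs
  refine (CentralExt.extension T).inl_injective ?_
  refine (CentralExt.inl_symbol T p q).trans ?_
  change _ = CentralExt.ofReal T s
  rw [commutatorElement_def, hpq]
  group

end Symbol
end ArithSurface

/-! ### Values of the commutator symbol -/

namespace ArithSurface

section Symbol

variable {R V G : Type*} [CommRing R] [AddCommGroup V] [Module R V] {𝔪 : Ideal R} [CommGroup G]
  [DistribMulAction G V] [SMulCommClass G R V] {A₀ E : Submodule R V}

theorem CentralExt.symbol_mul_right (T : IsNumerable 𝔪 (MulAction.orbit G A₀)) (f g g' : G) :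
    CentralExt.symbol T f (g * g') = CentralExt.symbol T f g * CentralExt.symbol T f g' :=
  commutatorSymbol_mul_right CentralExt.extension_central f g g'

theorem CentralExt.symbol_inv (T : IsNumerable 𝔪 (MulAction.orbit G A₀)) (f g : G) :
    (CentralExt.symbol T f g)⁻¹ = CentralExt.symbol T g f :=
  commutatorSymbol_inv CentralExt.extension_central f g

theorem IsLattice.isCompactOpen {A C L : Submodule R V} (h : IsLattice 𝔪 A C L) :
    IsCompactOpen 𝔪 A C L.toAddSubgroup :=
  ⟨L, L, h, h, le_rfl, le_rfl⟩

/-- The numeration of `A₀ / f A₀` in which the lattice `L` has number zero. -/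
theorem IsNumerable.exists_num_eq_zero (T : IsNumerable 𝔪 (MulAction.orbit G A₀)) {f : G}
    (hf : f • A₀ ≤ A₀) {L : Submodule R V} (hL : IsLattice 𝔪 A₀ (f • A₀) L) :
    ∃ n : Num 𝔪 A₀ (f • A₀), n.val _ hL.isCompactOpen = 0 := by
  obtain ⟨n⟩ := T.nonempty (A := baseLattice G A₀) (C := f • baseLattice G A₀) hf
  refine ⟨(-n.val _ hL.isCompactOpen) +ᵥ n, ?_⟩
  exact neg_add_cancel _

/-- The formula for the symbol in terms of the lattices `E + f A₀`, numerations being normalized so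
that these have number zero. -/
theorem CentralExt.symbol_eq_of_isLattice (T : IsNumerable 𝔪 (MulAction.orbit G A₀))
    (hE : ∀ f : G, f • A₀ ≤ A₀ → IsLattice 𝔪 A₀ (f • A₀) (E ⊔ f • A₀)) {f₁ f₂ : G}
    (h₁ : f₁ • A₀ ≤ A₀) (h₂ : f₂ • A₀ ≤ A₀) {n₁ : Num 𝔪 A₀ (f₁ • A₀)} {n₂ : Num 𝔪 A₀ (f₂ • A₀)}
    (hn₁ : n₁.val _ (hE f₁ h₁).isCompactOpen = 0) (hn₂ : n₂.val _ (hE f₂ h₂).isCompactOpen = 0)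
    {W₁ W₂ : Submodule R V} (hW₁ : W₁ = f₁⁻¹ • (E ⊓ f₁ • A₀) ⊔ f₂ • A₀)
    (hW₂ : W₂ = f₂⁻¹ • (E ⊓ f₂ • A₀) ⊔ f₁ • A₀)
    (k₁ : IsCompactOpen 𝔪 A₀ (f₂ • A₀) W₁.toAddSubgroup)
    (k₂ : IsCompactOpen 𝔪 A₀ (f₁ • A₀) W₂.toAddSubgroup) :
    CentralExt.symbol T f₁ f₂ = Multiplicative.ofAdd (n₁.val _ k₂ - n₂.val _ k₁) := by
  have h₁' : (f₁ * f₂) • A₀ ≤ f₁ • A₀ := by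
    rw [mul_smul]; exact smul_mono_right f₁ h₂
  have h₂' : (f₁ * f₂) • A₀ ≤ f₂ • A₀ := by
    rw [mul_comm, mul_smul]; exact smul_mono_right f₂ h₁
  have e : ∀ f : G, (f₁ * f₂) • A₀ ≤ f • A₀ → (E ⊔ (f₁ * f₂) • A₀).toAddSubgroup ⊔
      (f • A₀).toAddSubgroup = (E ⊔ f • A₀).toAddSubgroup := fun f hf => by
    rw [← Submodule.sup_toAddSubgroup, sup_assoc, sup_eq_right.2 hf]
  have e' : ∀ f g : G, (f₁ * f₂) • A₀ ≤ f • A₀ → f * g = f₁ * f₂ →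
      f⁻¹ • ((E ⊔ (f₁ * f₂) • A₀).toAddSubgroup ⊓ (f • A₀).toAddSubgroup) =
        (f⁻¹ • (E ⊓ f • A₀) ⊔ g • A₀).toAddSubgroup := fun f g hf hfg => by
    have h1 : (E ⊔ (f₁ * f₂) • A₀) ⊓ f • A₀ = (E ⊓ f • A₀) ⊔ (f₁ * f₂) • A₀ := by
      rw [sup_comm, sup_inf_assoc_of_le _ hf, sup_comm]
    have h2 : f⁻¹ • ((E ⊔ (f₁ * f₂) • A₀) ⊓ f • A₀) = f⁻¹ • (E ⊓ f • A₀) ⊔ g • A₀ := by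
      rw [h1, Submodule.smul_sup', ← mul_smul, ← hfg, inv_mul_cancel_left]
    exact congrArg Submodule.toAddSubgroup h2
  have e₁ := e' f₁ f₂ h₁' rfl
  have e₂ := e' f₂ f₁ h₂' (mul_comm _ _)
  rw [← hW₁] at e₁
  rw [← hW₂] at e₂
  rw [CentralExt.symbol_eq T h₁ h₂ n₁ n₂ (hE _ (h₁'.trans h₁)).isCompactOpen
    (by rw [e _ h₁']; exact (hE f₁ h₁).isCompactOpen)
    (by rw [e _ h₂']; exact (hE f₂ h₂).isCompactOpen)
    (by rw [e₁]; exact k₁) (by rw [e₂]; exact k₂),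
    n₂.val_congr (e _ h₂') _ (hE f₂ h₂).isCompactOpen,
    n₁.val_congr (e _ h₁') _ (hE f₁ h₁).isCompactOpen, hn₁, hn₂, zero_add, zero_add,
    n₁.val_congr e₂ _ k₂, n₂.val_congr e₁ _ k₁]

/-- The symbol of two elements `f` with `E ∩ f A₀ = f E`: both numerations in
`symbol_eq_of_isLattice` are evaluated where they vanish. -/
theorem CentralExt.symbol_eq_one_of_inf_eq (T : IsNumerable 𝔪 (MulAction.orbit G A₀))
    (hE : ∀ f : G, f • A₀ ≤ A₀ → IsLattice 𝔪 A₀ (f • A₀) (E ⊔ f • A₀)) {f₁ f₂ : G}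
    (h₁ : f₁ • A₀ ≤ A₀) (h₂ : f₂ • A₀ ≤ A₀) (h₁' : E ⊓ f₁ • A₀ = f₁ • E)
    (h₂' : E ⊓ f₂ • A₀ = f₂ • E) : CentralExt.symbol T f₁ f₂ = 1 := by
  obtain ⟨n₁, hn₁⟩ := T.exists_num_eq_zero h₁ (hE f₁ h₁)
  obtain ⟨n₂, hn₂⟩ := T.exists_num_eq_zero h₂ (hE f₂ h₂)
  rw [CentralExt.symbol_eq_of_isLattice T hE h₁ h₂ hn₁ hn₂ (by rw [h₁', inv_smul_smul])
    (by rw [h₂', inv_smul_smul]) (hE f₂ h₂).isCompactOpen (hE f₁ h₁).isCompactOpen, hn₁, hn₂,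
    sub_zero, ofAdd_zero]

/-- The symbol of two elements that map `A₀` onto itself: the quotients `A₀ / fᵢ A₀` are zero. -/
theorem CentralExt.symbol_eq_one_of_smul_eq (T : IsNumerable 𝔪 (MulAction.orbit G A₀))
    (hE : ∀ f : G, f • A₀ ≤ A₀ → IsLattice 𝔪 A₀ (f • A₀) (E ⊔ f • A₀)) (hEA : E ≤ A₀) {f₁ f₂ : G}
    (h₁ : f₁ • A₀ = A₀) (h₂ : f₂ • A₀ = A₀) : CentralExt.symbol T f₁ f₂ = 1 := by
  obtain ⟨n₁, hn₁⟩ := T.exists_num_eq_zero h₁.le (hE f₁ h₁.le)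
  obtain ⟨n₂, hn₂⟩ := T.exists_num_eq_zero h₂.le (hE f₂ h₂.le)
  have h : ∀ f g : G, f • A₀ = A₀ → g • A₀ = A₀ →
      E ⊔ g • A₀ = f⁻¹ • (E ⊓ f • A₀) ⊔ g • A₀ := fun f g hf hg => by
    have : f⁻¹ • (E ⊓ f • A₀) ≤ A₀ :=
      (smul_mono_right f⁻¹ inf_le_right).trans (inv_smul_smul f A₀).le
    rw [hg, sup_eq_right.2 hEA, sup_eq_right.2 this]
  rw [CentralExt.symbol_eq_of_isLattice T hE h₁.le h₂.le hn₁ hn₂ (h f₁ f₂ h₁ h₂) (h f₂ f₁ h₂ h₁)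
    (hE f₂ h₂.le).isCompactOpen (hE f₁ h₁.le).isCompactOpen, hn₁, hn₂, sub_zero, ofAdd_zero]

/-- The symbol of an element that maps `A₀` onto itself and an element `f` with `E ∩ f A₀ = f E`.
For `E = R` the index `[R : f₁ R + f₂ R]` is the order of the residue field to the power of the
intersection number of the divisors of `f₁` and `f₂`. -/
theorem CentralExt.symbol_eq_neg_log (T : IsNumerable 𝔪 (MulAction.orbit G A₀))
    (hE : ∀ f : G, f • A₀ ≤ A₀ → IsLattice 𝔪 A₀ (f • A₀) (E ⊔ f • A₀)) (hEA : E ≤ A₀) {f₁ f₂ : G}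
    (h₁ : f₁ • A₀ = A₀) (h₁E : f₁ • E ≤ E) (h₂ : f₂ • A₀ ≤ A₀) (h₂' : E ⊓ f₂ • A₀ = f₂ • E) :
    CentralExt.symbol T f₁ f₂ = Multiplicative.ofAdd
      (-Real.log ((f₁ • E ⊔ f₂ • E).toAddSubgroup.relIndex E.toAddSubgroup)) := by
  obtain ⟨n₁, hn₁⟩ := T.exists_num_eq_zero h₁.le (hE f₁ h₁.le)
  obtain ⟨n₂, hn₂⟩ := T.exists_num_eq_zero h₂ (hE f₂ h₂)
  have h₁₂ : f₁ • f₂ • A₀ = f₂ • A₀ := by rw [smul_smul, mul_comm, mul_smul, h₁]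
  have h₁₂' : f₁⁻¹ • f₂ • A₀ = f₂ • A₀ := inv_smul_eq_iff.2 h₁₂.symm
  -- translating `E + f₂ A₀` by `f₁⁻¹` gives the lattice at which `n₂` is evaluated
  have hW : IsLattice 𝔪 A₀ (f₂ • A₀) (f₁⁻¹ • (E ⊓ f₁ • A₀) ⊔ f₂ • A₀) := by
    have := (hE f₂ h₂).smul f₁⁻¹
    rw [h₁, inf_eq_left.2 hEA]
    rwa [h₁₂', inv_smul_eq_iff.2 h₁.symm, Submodule.smul_sup', h₁₂'] at this
  have hW₂ : E ⊔ f₁ • A₀ = f₂⁻¹ • (E ⊓ f₂ • A₀) ⊔ f₁ • A₀ := by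
    rw [h₂', inv_smul_smul]
  have hle : E ⊔ f₂ • A₀ ≤ f₁⁻¹ • (E ⊓ f₁ • A₀) ⊔ f₂ • A₀ := by
    refine sup_le_sup_right ?_ _
    rw [h₁, inf_eq_left.2 hEA]
    exact (inv_smul_smul f₁ E).ge.trans (smul_mono_right f₁⁻¹ h₁E)
  have hval := n₂.rule _ _ (hE f₂ h₂).isCompactOpen hW.isCompactOpen hle
  rw [CentralExt.symbol_eq_of_isLattice T hE h₁.le h₂ hn₁ hn₂ rfl hW₂ hW.isCompactOpen
    (hE f₁ h₁.le).isCompactOpen, hn₁, hval, hn₂, zero_add, zero_sub, h₁, inf_eq_left.2 hEA,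
    ← relIndex_smul f₁]
  have e₁ : f₁ • (E ⊔ f₂ • A₀) = f₁ • E ⊔ f₂ • A₀ := by rw [Submodule.smul_sup', h₁₂]
  have e₂ : f₁ • (f₁⁻¹ • E ⊔ f₂ • A₀) = (f₁ • E ⊔ f₂ • A₀) ⊔ E := by
    rw [Submodule.smul_sup', smul_inv_smul, h₁₂, sup_right_comm, sup_eq_right.2 h₁E]
  have e₃ : (f₁ • E ⊔ f₂ • A₀) ⊓ E = f₁ • E ⊔ f₂ • E := by
    rw [sup_inf_assoc_of_le _ h₁E, inf_comm, h₂']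
  have key : (f₁ • (E ⊔ f₂ • A₀)).toAddSubgroup.relIndex
      (f₁ • (f₁⁻¹ • E ⊔ f₂ • A₀)).toAddSubgroup =
      (f₁ • E ⊔ f₂ • E).toAddSubgroup.relIndex E.toAddSubgroup := by
    rw [e₁, e₂, Submodule.sup_toAddSubgroup (f₁ • E ⊔ f₂ • A₀),
      AddSubgroup.relIndex_sup_left, ← AddSubgroup.inf_relIndex_right, ← e₃]
    rfl
  exact congrArg (fun k : ℕ => Multiplicative.ofAdd (-Real.log k)) key

end Symbol
end ArithSurface

/-! ### The reciprocity law at a point of a curve -/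

namespace ArithSurface

section Reciprocity

variable {R V G : Type*} [CommRing R] [AddCommGroup V] [Module R V] {𝔪 : Ideal R} [CommGroup G]
  [DistribMulAction G V] [SMulCommClass G R V] {A B E : Submodule R V}

theorem inf_smul_eq_smul_of_smul_eq (hEA : E ≤ A) (hEB : E ≤ B) (h : A ⊓ B ≤ E) {f : G}
    (hfE : f • E ≤ E) (hf : f • A = A) : E ⊓ f • B = f • E := by
  refine le_antisymm ?_ (le_inf hfE (smul_mono_right f hEB))
  rintro v ⟨hv, ⟨b, hb, rfl⟩⟩
  have hv' : f • b ∈ f • A := hf.symm ▸ hEA hv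
  obtain ⟨a, ha, hab⟩ := hv'
  obtain rfl : a = b := MulAction.injective f hab
  exact ⟨a, h ⟨ha, hb⟩, rfl⟩

/-- Two subspaces `A` and `B` with `A ∩ B = E` have inverse symbols if every non-zero-divisor of
`R` is the product of one that maps `A` onto itself and one that maps `B` onto itself: by
bimultiplicativity only such elements matter, and for them both symbols are trivial or
logarithms, with opposite signs, of the same index `[E : f₁ E + f₂ E]`. -/
theorem symbol_mul_symbol_eq_one {φ : nonZeroDivisors R →* G}
    (hφ : ∀ a, ∀ v : V, φ a • v = (a : R) • v) (hG : ∀ f, ∃ a b, f = φ a * (φ b)⁻¹)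
    (hA : ∀ f : G, f • A ≤ A → IsLattice 𝔪 A (f • A) (E ⊔ f • A))
    (hB : ∀ f : G, f • B ≤ B → IsLattice 𝔪 B (f • B) (E ⊔ f • B))
    (hEA : E ≤ A) (hEB : E ≤ B) (h : A ⊓ B ≤ E)
    (hfac : ∀ a, ∃ g u, a = g * u ∧ φ g • B = B ∧ φ u • A = A)
    (TA : IsNumerable 𝔪 (translates G A)) (TB : IsNumerable 𝔪 (translates G B)) (f₁ f₂ : G) :
    CentralExt.symbol TA f₁ f₂ * CentralExt.symbol TB f₁ f₂ = 1 := by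
  have hEφ : ∀ a, φ a • E ≤ E := fun a => smul_le_of_smul_eq hφ a E
  have hAφ : ∀ a, φ a • A ≤ A := fun a => smul_le_of_smul_eq hφ a A
  have hBφ : ∀ a, φ a • B ≤ B := fun a => smul_le_of_smul_eq hφ a B
  have h' : B ⊓ A ≤ E := inf_comm A B ▸ h
  let P : G → G → Prop := fun f g => CentralExt.symbol TA f g * CentralExt.symbol TB f g = 1
  have symm : ∀ f g, P f g → P g f := fun f g hfg => by
    change _ * _ = _
    rw [← CentralExt.symbol_inv TA, ← CentralExt.symbol_inv TB, ← mul_inv, hfg, inv_one]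
  have gg : ∀ a b, φ a • B = B → φ b • B = B → P (φ a) (φ b) := fun a b ha hb => by
    change _ * _ = _
    rw [CentralExt.symbol_eq_one_of_smul_eq TB hB hEB ha hb,
      CentralExt.symbol_eq_one_of_inf_eq TA hA
      (hAφ a) (hAφ b) (inf_smul_eq_smul_of_smul_eq hEB hEA h' (hEφ a) ha)
      (inf_smul_eq_smul_of_smul_eq hEB hEA h' (hEφ b) hb), one_mul]
  have uu : ∀ a b, φ a • A = A → φ b • A = A → P (φ a) (φ b) := fun a b ha hb => by
    change _ * _ = _
    rw [CentralExt.symbol_eq_one_of_smul_eq TA hA hEA ha hb,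
      CentralExt.symbol_eq_one_of_inf_eq TB hB
      (hBφ a) (hBφ b) (inf_smul_eq_smul_of_smul_eq hEA hEB h (hEφ a) ha)
      (inf_smul_eq_smul_of_smul_eq hEA hEB h (hEφ b) hb), one_mul]
  -- the two logarithms of `[E : φ a E + φ b E]` cancel, by the antisymmetry of the symbol
  have ug : ∀ a b, φ a • A = A → φ b • B = B → P (φ a) (φ b) := fun a b ha hb => by
    change _ * _ = _
    rw [← CentralExt.symbol_inv TB, CentralExt.symbol_eq_neg_log TA hA hEA ha (hEφ a) (hAφ b)
      (inf_smul_eq_smul_of_smul_eq hEB hEA h' (hEφ b) hb),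
      CentralExt.symbol_eq_neg_log TB hB hEB hb (hEφ b) (hBφ a)
      (inf_smul_eq_smul_of_smul_eq hEA hEB h (hEφ a) ha), sup_comm, mul_inv_cancel]
  -- the product of the symbols is a character in the second argument
  have gen : ∀ f, (∀ a, φ a • B = B → P f (φ a)) → (∀ a, φ a • A = A → P f (φ a)) → ∀ g, P f g := by
    intro f hg hu g
    let χ : G →* Multiplicative ℝ := MonoidHom.mk'
      (fun g => CentralExt.symbol TA f g * CentralExt.symbol TB f g) fun g g' => by
        rw [CentralExt.symbol_mul_right, CentralExt.symbol_mul_right, mul_mul_mul_comm]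
    have hχ : ∀ a, χ (φ a) = 1 := by
      intro a
      obtain ⟨c, d, rfl, hc, hd⟩ := hfac a
      rw [map_mul, map_mul]
      exact (congrArg₂ (· * ·) (hg c hc) (hu d hd)).trans (one_mul 1)
    obtain ⟨a, b, rfl⟩ := hG g
    change χ _ = 1
    rw [map_mul, map_inv, hχ, hχ, inv_one, one_mul]
  refine gen f₁ (fun b hb => symm _ _ ?_) (fun b hb => symm _ _ ?_) f₂
  · exact gen _ (fun a ha => gg b a hb ha) (fun a ha => symm _ _ (ug a b ha hb)) f₁
  · exact gen _ (fun a ha => ug b a hb ha) (fun a ha => uu b a hb ha) f₁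

end Reciprocity

open IsLocalRing

/-- The reciprocity law in a Noetherian local ring with a local equation of a curve. Completeness is
not needed. -/
theorem IsLocalEquation.reciprocity {R : Type*} [CommRing R] [IsNoetherianRing R] [IsLocalRing R]
    [Finite (ResidueField R)] {t : R} (ht : IsLocalEquation t) :
    ∃ (TB : IsNumerable (maximalIdeal R)
        (translates (FractionRing R)ˣ (pointLattice R (Ideal.span {t}))))
      (TO : IsNumerable (maximalIdeal R)
        (translates (FractionRing R)ˣ (curveLattice R (Ideal.span {t})))),
      ∀ f₁ f₂ : (FractionRing R)ˣ, pointSymbol TB f₁ f₂ * curveSymbol TO f₁ f₂ = 1 := by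
  have hφ : ∀ a : nonZeroDivisors R, ∀ v : CurveLocalRing R (Ideal.span {t}),
      fractionUnit a • v = (a : R) • v := fractionUnit_smul
  have hfin : Finite (R ⧸ maximalIdeal R) := ‹Finite (ResidueField R)›
  have hE : (1 : Submodule R (CurveLocalRing R (Ideal.span {t}))).FG :=
    Submodule.one_eq_span (R := R) (A := CurveLocalRing R (Ideal.span {t})) ▸
      Submodule.fg_span_singleton _
  have hEB := one_le_pointLattice ht.mem_nonZeroDivisors
  have hEO := one_le_curveLattice (Ideal.span {t})
  refine ⟨isNumerable_translates hφ exists_eq_fractionUnit_mul_inv hE hEB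
    fun a v hv => ht.exists_smul_mem_pointLattice a hv,
    isNumerable_translates hφ exists_eq_fractionUnit_mul_inv hE hEO
    fun a v hv => ht.exists_smul_mem_curveLattice a hv, fun f₁ f₂ => ?_⟩
  refine symbol_mul_symbol_eq_one hφ exists_eq_fractionUnit_mul_inv
    (fun f hf => isLattice_sup_smul hφ exists_eq_fractionUnit_mul_inv hE hEB
      (fun a v hv => ht.exists_smul_mem_pointLattice a hv) hf)
    (fun f hf => isLattice_sup_smul hφ exists_eq_fractionUnit_mul_inv hE hEO
      (fun a v hv => ht.exists_smul_mem_curveLattice a hv) hf)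
    hEB hEO ht.pointLattice_inf_curveLattice (fun a => ?_) _ _ f₁ f₂
  obtain ⟨g, u, h, ⟨w, n, hu⟩, hg⟩ := ht.exists_eq_mul a
  exact ⟨g, u, h, fractionUnit_smul_curveLattice hg,
    fractionUnit_smul_pointLattice ht.mem_nonZeroDivisors hu⟩

end ArithSurface

/-! ### Completions of Noetherian rings -/

namespace AdicCompletion

/-- A surjective ring homomorphism `P → A` that maps the ideal `J` onto `I` induces a surjection
`P̂ → Â` of completions, since Cauchy sequences can be lifted term by term. -/
theorem isNoetherianRing_of_surjective_of_map_eq {P A : Type*} [CommRing P] [CommRing A]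
    {J : Ideal P} {I : Ideal A} {φ : P →+* A} (hφ : Function.Surjective φ) (hJ : J.map φ = I)
    [IsNoetherianRing (AdicCompletion J P)] : IsNoetherianRing (AdicCompletion I A) := by
  have hpow : ∀ n, J ^ n ≤ (I ^ n).comap φ := fun n =>
    Ideal.map_le_iff_le_comap.1 (by rw [Ideal.map_pow, hJ])
  let f : ∀ n, AdicCompletion J P →+* A ⧸ I ^ n := fun n =>
    (Ideal.quotientMap (I ^ n) φ (hpow n)).comp (evalₐ J n : AdicCompletion J P →+* P ⧸ J ^ n)
  have hf_mk : ∀ n (x : AdicCauchySequence J P),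
      f n (mk J P x) = Ideal.Quotient.mk (I ^ n) (φ (x.val n)) := fun n x => by
    simp only [f, RingHom.comp_apply, RingHom.coe_coe, evalₐ_mk, Ideal.quotientMap_mk]
  have hf : ∀ {m n : ℕ} (hle : m ≤ n), (Ideal.Quotient.factorPow I hle).comp (f n) = f m := by
    intro m n hle
    ext x
    obtain ⟨x, rfl⟩ := mk_surjective J P x
    rw [RingHom.comp_apply, hf_mk, hf_mk]
    refine (Ideal.Quotient.factor_mk _ _).trans (Ideal.Quotient.eq.2 ?_)
    rw [← map_sub]
    refine hpow m ?_
    have := SModEq.sub_mem.1 (x.property hle).symm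
    simpa using this
  refine isNoetherianRing_of_surjective _ _ (liftRingHom I f hf) fun y => ?_
  obtain ⟨y, rfl⟩ := mk_surjective I A y
  have hd : ∀ n, ∃ d ∈ J ^ n, φ d = y.val (n + 1) - y.val n := by
    intro n
    rw [← Ideal.mem_map_iff_of_surjective φ hφ, Ideal.map_pow, hJ]
    have := SModEq.sub_mem.1 (y.property n.le_succ).symm
    simpa using this
  choose d hdJ hd using hd
  obtain ⟨p₀, hp₀⟩ := hφ (y.val 0)
  let p : ℕ → P := fun n => p₀ + ∑ k ∈ Finset.range n, d k
  have hp : ∀ n, φ (p n) = y.val n := by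
    intro n
    rw [map_add, map_sum, hp₀, Finset.sum_congr rfl fun k _ => hd k, Finset.sum_range_sub]
    abel
  refine ⟨mk J P (AdicCauchySequence.mk J P p fun n => ?_), ext_evalₐ fun n => ?_⟩
  · refine (SModEq.sub_mem.2 ?_).symm
    have : p (n + 1) - p n = d n := by
      simp only [p, Finset.sum_range_succ]
      abel
    rw [this]
    simpa using hdJ n
  · rw [evalₐ_liftRingHom, hf_mk, evalₐ_mk]
    exact congrArg _ (hp n)

/-- The completion of a Noetherian ring `A` along an ideal generated by `n` elements is a quotient
of the ring of power series in `n` variables over `A`. -/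
theorem isNoetherianRing {A : Type*} [CommRing A] [IsNoetherianRing A] (I : Ideal A) :
    IsNoetherianRing (AdicCompletion I A) := by
  obtain ⟨s, rfl⟩ := IsNoetherian.noetherian I
  have : IsNoetherianRing (AdicCompletion (MvPolynomial.idealOfVars s A) (MvPolynomial s A)) :=
    isNoetherianRing_of_ringEquiv _ (MvPowerSeries.toAdicCompletionAlgEquiv s A).toRingEquiv
  refine isNoetherianRing_of_surjective_of_map_eq
    (φ := MvPolynomial.eval ((↑) : s → A))
    (J := MvPolynomial.idealOfVars s A) (fun a => ⟨MvPolynomial.C a, MvPolynomial.eval_C a⟩) ?_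
  rw [Ideal.map_span, ← Set.range_comp]
  congr 1
  ext a
  simp

end AdicCompletion

/-! ### Local equations in the completion -/

namespace ArithSurface

open IsLocalRing

/-- Flatness preserves the ideal quotient `((t) : s)`. -/
theorem mem_span_of_mul_mem_span_of_flat {A S : Type*} [CommRing A] [CommRing S] [Algebra A S]
    [Module.Flat A S] {s t : A} (h : ∀ a, s * a ∈ Ideal.span {t} → a ∈ Ideal.span {t}) {a : S}
    (ha : algebraMap A S s * a ∈ Ideal.span {algebraMap A S t}) :
    a ∈ Ideal.span {algebraMap A S t} := by
  obtain ⟨b, hb⟩ := Ideal.mem_span_singleton'.1 ha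
  obtain ⟨k, c, y, hy, hc⟩ := Module.Flat.isTrivialRelation_of_sum_smul_eq_zero
    (R := A) (f := ![s, t]) (x := ![a, -b]) (by simp [Algebra.smul_def, ← hb, mul_comm b])
  have h0 : a = ∑ j, c 0 j • y j := hy 0
  rw [h0]
  refine Ideal.sum_mem _ fun j _ => ?_
  have hj : s * c 0 j + t * c 1 j = 0 := by simpa using hc j
  obtain ⟨d, hd⟩ := Ideal.mem_span_singleton'.1
    (h (c 0 j) (Ideal.mem_span_singleton'.2 ⟨-c 1 j, by linear_combination -hj⟩))
  rw [Algebra.smul_def, ← hd, map_mul]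
  exact Ideal.mul_mem_right _ _ (Ideal.mul_mem_left _ _ (Ideal.mem_span_singleton_self _))

theorem IsLocalEquation.algebraMap_of_flat {A S : Type*} [CommRing A] [IsLocalRing A] [CommRing S]
    [IsLocalRing S] [Algebra A S] [Module.Flat A S] {t : A} (ht : IsLocalEquation t)
    (hS : maximalIdeal S = (maximalIdeal A).map (algebraMap A S)) :
    IsLocalEquation (algebraMap A S t) where
  exists_generators := by
    obtain ⟨x, y, hxy⟩ := ht.exists_generators
    refine ⟨algebraMap A S x, algebraMap A S y, ?_⟩
    rw [hS, hxy, Ideal.map_span, Set.image_pair]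
  mem := hS ▸ Ideal.mem_map_of_mem _ ht.mem
  mem_nonZeroDivisors := by
    refine mem_nonZeroDivisors_iff_right.2 fun a ha => ?_
    refine Module.Flat.isSMulRegular_of_nonZeroDivisors (M := S) ht.mem_nonZeroDivisors ?_
    change t • a = t • 0
    rw [smul_zero, Algebra.smul_def, mul_comm, ha]
  exists_regular := by
    obtain ⟨s, hs, h⟩ := ht.exists_regular
    exact ⟨algebraMap A S s, hS ▸ Ideal.mem_map_of_mem _ hs,
      fun a => mem_span_of_mul_mem_span_of_flat h⟩

/-- In a Noetherian local domain whose maximal ideal has two generators, a prime ideal other than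
zero and the maximal ideal is generated by a local equation. -/
theorem exists_isLocalEquation_of_isPrime {A : Type*} [CommRing A] [IsDomain A] [IsNoetherianRing A]
    [IsLocalRing A] (hA : ∃ x y : A, maximalIdeal A = Ideal.span {x, y}) {P : Ideal A} [P.IsPrime]
    (h0 : P ≠ ⊥) (hm : P ≠ maximalIdeal A) : ∃ t, P = Ideal.span {t} ∧ IsLocalEquation t := by
  have hPm := le_maximalIdeal (‹P.IsPrime›.ne_top)
  obtain ⟨s, hs, hsP⟩ := SetLike.exists_of_lt (lt_of_le_of_ne hPm hm)
  have hreg : ∀ a, s * a ∈ P → a ∈ P := fun a ha => (‹P.IsPrime›.mem_or_mem ha).resolve_left hsP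
  obtain ⟨x, y, hxy⟩ := hA
  obtain ⟨t, rfl⟩ := exists_eq_span_of_regular hxy hs hreg
  refine ⟨t, rfl, ⟨x, y, hxy⟩, hPm (Ideal.mem_span_singleton_self t),
    mem_nonZeroDivisors_of_ne_zero ?_, s, hs, hreg⟩
  rintro rfl
  exact h0 (by simp)

end ArithSurface

/-! ### The local rings of an arithmetic surface -/

namespace ArithSurface

open IsLocalRing TopologicalSpace

theorem exists_eq_span_pair_of_spanFinrank_le {A : Type*} [CommRing A] {I : Ideal A} (hI : I.FG)
    (h : I.spanFinrank ≤ 2) : ∃ x y : A, I = Ideal.span {x, y} := by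
  obtain ⟨s, hs, rfl⟩ := Submodule.FG.exists_span_set_encard_eq_spanFinrank hI
  have hs2 : s.encard ≤ 2 := hs ▸ mod_cast h
  rcases hs2.lt_or_eq with hs1 | hs2
  · have hs1 : s.encard < 1 + 1 := by rwa [one_add_one_eq_two]
    rcases Set.encard_le_one_iff_eq.1 (ENat.lt_add_one_iff ENat.one_ne_top |>.1 hs1)
      with rfl | ⟨x, rfl⟩
    · exact ⟨0, 0, by simp⟩
    · exact ⟨x, x, by simp⟩
  · obtain ⟨x, y, -, rfl⟩ := Set.encard_eq_two.1 hs2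
    exact ⟨x, y, rfl⟩

theorem coheight_le_topologicalKrullDim {X : Scheme.{u}} (x : X) :
    (Order.coheight x : WithBot ℕ∞) ≤ topologicalKrullDim X := by
  let := specializationOrder X
  exact (Order.coheight_le_krullDim x).trans
    (Order.krullDim_le_of_strictMono _ irreducibleSetEquivPoints.symm.strictMono)

section CurveIdeal

variable {X : Scheme.{u}} (C : IrreducibleCloseds X) {x : X} (hx : x ∈ C)

instance isPrime_curveIdeal : (curveIdeal C hx).IsPrime := Ideal.comap_isPrime _ _

/-- The ideal of `C` is the point of `Spec 𝒪_{X,x}` that lies over the generic point of `C`. -/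
theorem fromSpecStalk_curveIdeal :
    X.fromSpecStalk x ⟨curveIdeal C hx, inferInstance⟩ = C.isIrreducible.genericPoint := by
  have h := Scheme.SpecMap_stalkSpecializes_fromSpecStalk (genericPoint_specializes C hx)
  have h' := Scheme.fromSpecStalk_closedPoint (X := X) (x := C.isIrreducible.genericPoint)
  rw [← h] at h'
  exact h'

/-- If the ideal of `C` is maximal, the generic point of `C` is the closed point `x`, and `C` has
dimension zero. -/
theorem curveIdeal_ne_maximalIdeal (hC : topologicalKrullDim C = 1) (hx' : IsClosed {x}) :
    curveIdeal C hx ≠ maximalIdeal (X.presheaf.stalk x) := by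
  intro h
  have h1 : C.isIrreducible.genericPoint = x := by
    rw [← fromSpecStalk_curveIdeal C hx]
    refine Eq.trans ?_ (Scheme.fromSpecStalk_closedPoint (X := X) (x := x))
    congr 1
    exact PrimeSpectrum.ext h
  have h2 : (C : Set X) = {x} := by
    rw [← C.isClosed.closure_eq, ← C.isIrreducible.genericPoint_closure_eq, h1, hx'.closure_eq]
  have : Subsingleton C := (Set.subsingleton_coe (C : Set X)).2 (h2 ▸ Set.subsingleton_singleton)
  have h0 : topologicalKrullDim C ≤ 0 := topologicalKrullDim_zero_of_discreteTopology C
  exact absurd (hC ▸ h0) (by decide)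

/-- If the ideal of `C` is zero, the generic point of `C` specializes to that of `X`, and `C` is all
of `X`. -/
theorem curveIdeal_ne_bot [IsIntegral X] (hC : topologicalKrullDim C ≠ topologicalKrullDim X) :
    curveIdeal C hx ≠ ⊥ := by
  intro h
  refine hC ?_
  have hξ := _root_.genericPoint_specializes x
  obtain ⟨q, hq⟩ : genericPoint X ∈ Set.range (X.fromSpecStalk x) := by
    rw [Scheme.range_fromSpecStalk]
    exact hξ
  have hs : C.isIrreducible.genericPoint ⤳ genericPoint X := by
    rw [← fromSpecStalk_curveIdeal C hx, ← hq]
    refine Specializes.map ?_ (X.fromSpecStalk x).continuous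
    refine (PrimeSpectrum.le_iff_specializes _ _).1 ?_
    change curveIdeal C hx ≤ q.asIdeal
    exact h ▸ bot_le
  have hC' : (C : Set X) = Set.univ := by
    refine Set.eq_univ_of_forall fun y => ?_
    rw [← C.isClosed.closure_eq, ← C.isIrreducible.genericPoint_closure_eq,
      ← specializes_iff_mem_closure]
    exact hs.trans (_root_.genericPoint_specializes y)
  exact IsHomeomorph.topologicalKrullDim_eq _
    ((Homeomorph.setCongr hC').trans (Homeomorph.Set.univ X)).isHomeomorph

end CurveIdeal

theorem isJacobsonRing_int : IsJacobsonRing ℤ := by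
  refine isJacobsonRing_iff_prime_eq.2 fun P hP => ?_
  by_cases h : P = ⊥
  · rw [h, eq_bot_iff]
    intro z hz
    -- the number `z ^ 2 + 1` is a unit only for `z = 0`
    have := Int.isUnit_iff.1 (Ideal.mem_jacobson_bot.1 hz z)
    rw [Ideal.mem_bot]
    rcases this with h | h <;> nlinarith
  · have := hP.isMaximal h
    exact Ideal.jacobson_eq_self_of_isMaximal

open scoped NumberField in
theorem finite_of_ringHom_finite {F K : Type*} [Field F] [NumberField F] [Field K] (φ : 𝓞 F →+* K)
    (hφ : φ.Finite) : Finite K := by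
  have : (RingHom.ker φ).IsMaximal :=
    Ideal.isMaximal_comap_of_isIntegral_of_isMaximal' _ hφ.to_isIntegral ⊥
  let := (RingHom.kerLift φ).toAlgebra
  have : Module.Finite (𝓞 F ⧸ RingHom.ker φ) K :=
    RingHom.Finite.of_comp_finite (f := Ideal.Quotient.mk _) (g := RingHom.kerLift φ) hφ
  exact Module.finite_of_finite (𝓞 F ⧸ RingHom.ker φ) (M := K)

/-- By Zariski's lemma over the Jacobson ring `𝒪_F`, the residue field of a closed point is a finite
module over `𝒪_F`, hence over a residue field of `𝒪_F`. -/
theorem finite_residueField_of_isClosed {F : Type u} [Field F] [NumberField F] {X : Scheme.{u}}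
    (π : X ⟶ Spec (CommRingCat.of (NumberField.RingOfIntegers F))) [LocallyOfFiniteType π] {x : X}
    (hx : IsClosed {x}) : Finite (ResidueField (X.presheaf.stalk x)) := by
  have : IsJacobsonRing ℤ := isJacobsonRing_int
  have : IsJacobsonRing (NumberField.RingOfIntegers F) := isJacobsonRing_of_isIntegral (R := ℤ)
  have := isClosed_singleton_iff_isClosedImmersion.mp hx
  have h := (isFinite_iff_locallyOfFiniteType_of_jacobsonSpace
    (f := X.fromSpecResidueField x ≫ π)).mpr inferInstance
  obtain ⟨φ, hφ⟩ := Spec.map_surjective (X.fromSpecResidueField x ≫ π)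
  rw [← hφ, IsFinite.SpecMap_iff] at h
  exact finite_of_ringHom_finite φ.hom h

end ArithSurface

theorem mainTheorem11 {F : Type u} [Field F] [NumberField F] {X : Scheme.{u}}
    (π : X ⟶ Spec (CommRingCat.of (NumberField.RingOfIntegers F)))
    (hπ : IsRegularArithmeticSurface F π)
    (C : TopologicalSpace.IrreducibleCloseds X) (hC : topologicalKrullDim C = 1)
    (x : X) (hx : IsClosed {x}) (hxC : x ∈ C) :
    ∃ (TB : IsNumerable (completedMaximalIdeal x)
        (translates (FractionRing (CompletedStalk x))ˣ
          (pointLattice (CompletedStalk x) (completedCurveIdeal C hxC))))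
      (TO : IsNumerable (completedMaximalIdeal x)
        (translates (FractionRing (CompletedStalk x))ˣ
          (curveLattice (CompletedStalk x) (completedCurveIdeal C hxC)))),
      ∀ f₁ f₂ : (FractionRing (CompletedStalk x))ˣ,
        pointSymbol TB f₁ f₂ * curveSymbol TO f₁ f₂ = 1 := by
  have := hπ.integral
  have := hπ.proper
  have := hπ.regular x
  have : Finite (IsLocalRing.ResidueField (X.presheaf.stalk x)) :=
    finite_residueField_of_isClosed π hx
  have : IsNoetherianRing (CompletedStalk x) := AdicCompletion.isNoetherianRing _
  have : Finite (IsLocalRing.ResidueField (CompletedStalk x)) :=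
    Finite.of_surjective _ (AdicCompletion.residueField_map_bijective _).2
  have hdim : (IsLocalRing.maximalIdeal (X.presheaf.stalk x)).spanFinrank ≤ 2 := by
    have h : ((IsLocalRing.maximalIdeal (X.presheaf.stalk x)).spanFinrank : WithBot ℕ∞) ≤ 2 := by
      rw [IsRegularLocalRing.spanFinrank_maximalIdeal, ringKrullDim_stalk_eq_coheight, ← hπ.dim]
      exact coheight_le_topologicalKrullDim x
    exact_mod_cast h
  obtain ⟨t, ht, hloc⟩ := exists_isLocalEquation_of_isPrime
    (exists_eq_span_pair_of_spanFinrank_le (IsNoetherian.noetherian _) hdim)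
    (curveIdeal_ne_bot C hxC (by rw [hC, hπ.dim]; exact OfNat.one_ne_ofNat 2))
    (curveIdeal_ne_maximalIdeal C hxC hC hx)
  have h := (hloc.algebraMap_of_flat (S := CompletedStalk x)
    AdicCompletion.maximalIdeal_eq_map).reciprocity
  rw [AdicCompletion.maximalIdeal_eq_map, ← Set.image_singleton, ← Ideal.map_span, ← ht] at h
  exact h
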